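/- Let $G=(U\,\dot\cup\,V,E)$ be a finite simple bipartite graph with maximum degree $\Delta$, and let $\eta_e\in\mathbb{R}$ for $e\in E$. Put $\bar\Delta:=2\Delta-2$, and let $\deg_G(e)$ denote the number of edges that share exactly one endpoint with $e$. For an orientation of the edges of $G$, let $x_w$ be the number of edges oriented towards the node $w$. The orientation is a *generalized $(\varepsilon,\beta)$-balanced edge orientation* w.r.t. $(\eta_e)$ if for every edge $e=\{u,v\}$ with $u\in U$, $v\in V$: if $e$ is oriented from $u$ to $v$, then $x_v-x_u\le \eta_e+1+\frac{\varepsilon}{2}\deg_G(e)+\beta$; and if $e$ is oriented from $v$ to $u$, then $x_u-x_v\le -\eta_e+1+\frac{\varepsilon}{2}\deg_G(e)+\beta$. There are universal constants (independent of $G$, of $\varepsilon$ and of the $\eta_e$), among them $C>0$, and a deterministic synchronous message-passing algorithm in the CONGEST model (messages of $O(\log n)$ bits, $n$ the number of nodes, unrestricted internal computation) such that the following holds. Suppose that $0<\varepsilon\le 1$ and that each node initially knows $n$, $\Delta$, $\varepsilon$, its unique identifier, its side of the bipartition ($U$ or $V$), and the value $\eta_e$ of each incident edge $e$. Then after $O\!\left(\frac{\log^4\Delta}{\varepsilon^6}\right)$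 rounds the algorithm stops, and the nodes output (each node the orientation of its incident edges, consistently) a generalized $(\varepsilon,\beta)$-balanced edge orientation of $G$ w.r.t. $(\eta_e)$, where $$\beta=C\cdot\frac{\ln^3\bar\Delta}{\varepsilon^5}.$$ (For $\Delta\le 1$, where $\ln\bar\Delta$ is undefined, $\beta$ is read as $0$ and the number of rounds is $0$.) -/

import Mathlib

namespace BalancedOrientation

/-! ### Edge orientations -/

/-- The degree of an edge `e` in `G`: the number of edges of `G` that are adjacent to `e`, that is,
different from `e` and sharing an endpoint with `e`. -/
noncomputable def edgeDegree {V : Type*} (G : SimpleGraph V) (e : Sym2 V) : ℕ :=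
  {e' : Sym2 V | e' ∈ G.edgeSet ∧ e' ≠ e ∧ ∃ w, w ∈ e ∧ w ∈ e'}.ncard

/-- `D` is an orientation of the edges of `G`: `D u v` says that `{u, v}` is an edge that is
oriented from `u` to `v`, and each edge of `G` is oriented in exactly one direction. -/
structure IsOrientation {V : Type*} (G : SimpleGraph V) (D : V → V → Prop) : Prop where
  adj_of_oriented : ∀ u v, D u v → G.Adj u v
  oriented_of_adj : ∀ u v, G.Adj u v → D u v ∨ D v u
  not_both : ∀ u v, D u v → ¬ D v u

/-- `x_w`, the number of edges that are oriented towards `w`. -/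
noncomputable def inDegree {V : Type*} (D : V → V → Prop) (w : V) : ℕ :=
  {u : V | D u w}.ncard

/-- Generalized `(ε, β)`-balanced edge orientations of a 2-colored bipartite graph with respect to
the edge parameters `η`; the color `true` marks the nodes of the side `U`, the color `false` those
of the side `V`. Only the values of `η` on edges of `G` matter. -/
structure IsBalancedOrientation {V : Type*} (G : SimpleGraph V) (side : G.Coloring Bool)
    (η : Sym2 V → ℝ) (ε β : ℝ) (D : V → V → Prop) : Prop extends IsOrientation G D where
  balanced_right : ∀ u v, side u = true → side v = false → D u v →
    (inDegree D v : ℝ) - (inDegree D u : ℝ)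
      ≤ η s(u, v) + 1 + ε / 2 * (edgeDegree G s(u, v) : ℝ) + β
  balanced_left : ∀ u v, side u = true → side v = false → D v u →
    (inDegree D u : ℝ) - (inDegree D v : ℝ)
      ≤ -η s(u, v) + 1 + ε / 2 * (edgeDegree G s(u, v) : ℝ) + β

/-! ### Deterministic synchronous message passing -/

/-- The global quantities that are known to all nodes: the number of nodes, the maximum degree of
the graph, and the accuracy parameter. -/
structure Params where
  numNodes : ℕ
  maxDegree : ℕ
  ε : ℝ

/-- The initial knowledge of a node: the global quantities, its identifier, whether it belongs to
the side `U`, its degree, and the parameter of each of its edges. The incident edges are addressed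
by ports. -/
structure NodeInput where
  params : Params
  ident : ℕ
  inU : Bool
  degree : ℕ
  η : Fin degree → ℝ

/-- A deterministic synchronous distributed algorithm for edge orientation. Internal computation is
unrestricted. In every round, a node sends a (possibly different) bit string through each of its
ports, and computes its new state from its old state and the bit strings that arrive at its
ports. All nodes stop after a number of rounds that is determined by the globally known quantities;
then each node declares for each of its ports whether the edge at this port is oriented
towards the node. `State d` is the set of states of a node of degree `d`. -/
structure Algorithm where
  State : ℕ → Type
  init : (I : NodeInput) → State I.degree
  send : {d : ℕ} → State d → Fin d → List Bool
  update : {d : ℕ} → State d → (Fin d → List Bool) → State d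
  rounds : Params → ℕ
  output : {d : ℕ} → State d → Fin d → Bool

/-- The data with which a graph `G` is equipped when an algorithm is run on it: a 2-coloring of the
nodes, edge parameters, unique identifiers and, for each node, a numbering of its incident edges
(identified with the neighbors). -/
structure Network {V : Type*} [Fintype V] (G : SimpleGraph V) [DecidableRel G.Adj] where
  side : G.Coloring Bool
  η : Sym2 V → ℝ
  ident : V → ℕ
  ident_injective : Function.Injective ident
  port : (v : V) → G.neighborSet v ≃ Fin (G.degree v)

namespace Network

variable {V : Type*} [Fintype V] {G : SimpleGraph V} [DecidableRel G.Adj]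

/-- The global quantities of a run on `G` with accuracy parameter `ε`. -/
def params (_N : Network G) (ε : ℝ) : Params where
  numNodes := Fintype.card V
  maxDegree := G.maxDegree
  ε := ε

/-- The neighbor of `v` at port `i`. -/
def neighbor (N : Network G) (v : V) (i : Fin (G.degree v)) : V :=
  ((N.port v).symm i : V)

theorem adj_neighbor (N : Network G) (v : V) (i : Fin (G.degree v)) :
    G.Adj v (N.neighbor v i) :=
  ((N.port v).symm i).2

/-- The port at which the neighbor of `v` at port `i` sees `v`. -/
def backPort (N : Network G) (v : V) (i : Fin (G.degree v)) :
    Fin (G.degree (N.neighbor v i)) :=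
  N.port (N.neighbor v i) ⟨v, (N.adj_neighbor v i).symm⟩

/-- The initial knowledge of node `v`. -/
def nodeInput (N : Network G) (ε : ℝ) (v : V) : NodeInput where
  params := N.params ε
  ident := N.ident v
  inU := N.side v
  degree := G.degree v
  η := fun i => N.η s(v, N.neighbor v i)

/-- The states of all nodes after `t` rounds. -/
def state (N : Network G) (A : Algorithm) (ε : ℝ) : ℕ → (v : V) → A.State (G.degree v)
  | 0, v => A.init (N.nodeInput ε v)
  | t + 1, v => A.update (N.state A ε t v)
      (fun i => A.send (N.state A ε t (N.neighbor v i)) (N.backPort v i))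

/-- The outcome of the algorithm: the edge `{u, v}` is oriented from `u` to `v` according to `v`
when the algorithm stops. That both endpoints declare the same orientation is part
of `IsOrientation`. -/
def outcome (N : Network G) (A : Algorithm) (ε : ℝ) (u v : V) : Prop :=
  ∃ h : G.Adj v u, A.output (N.state A ε (A.rounds (N.params ε)) v) (N.port v ⟨u, h⟩) = true

/-- Every message sent during the run consists of at most `B` bits. -/
def MessagesBounded (N : Network G) (A : Algorithm) (ε : ℝ) (B : ℕ) : Prop :=
  ∀ t < A.rounds (N.params ε), ∀ (v : V) (i : Fin (G.degree v)),
    (A.send (N.state A ε t v) i).length ≤ B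

end Network

end BalancedOrientation

/-! ### Node variables, communication rounds and the schedule. -/

namespace BalancedOrientation

/-! Let the load `x_v` be the number of edges directed towards `v`, and call `x_v - x_w - θ(v,w)`
the excess of an edge directed from `w` to `v`, where `θ` is `-η` seen from `U` and `η` seen from
`V`. The final excess must be at most `1 + (ε/2) deg(e) + β`.

Edges are oriented in `L ≈ log Δ / ε` phases. When phase `φ` starts, the numbers of unoriented edges
at the two ends of an unoriented edge sum to at most `D φ + 1`, where `D` decays geometrically.
Edges violating the next bound propose to the end they prefer under the current loads, and a node
accepts at most `k = D φ - D (φ+1)` of them. A rejected edge has an end that accepted `k` edges, so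
it meets the next bound. As `k` is about `ε D φ / 32` and an edge is oriented only if its degree is
at least `D (φ+1)`, the load increase is small compared with `ε deg(e)`.

Accepted edges raise loads and could spoil older edges. A token game repairs this: a token at `v` is
an edge directed towards `v`, and passing it reverses the edge. Only edges with nonnegative excess
at the start of the phase take part, each at most once. Levels start at the old loads and end with
level ≤ load ≤ level + 2α + δ, where `α ≈ deg/Q`. The levels of the ends of an unused edge drift
apart by `δ` only when one end passes or requests a full batch of `α` tokens, which happens `O(Q²)`
times (`IsTokenRun.level_sub_le`). Hence the excess of an unused edge grows by at most `(Q+1)²δ +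
2α`, and every other edge restarts below `Sδ + 2α + δ` (`Network.imbalance_afterPhase`).

Since `δ ≤ k/S + 1` and the `k` telescope, `Q ≈ L/ε` and `S ≈ Q²/ε` keep all degree-proportional
terms below `(ε/2) deg(e)`. What remains is `β = O(S + LQ²)`, and the number of rounds is `O(LS)`.
-/

open Classical in
/-- A subset of `s` with `min k s.card` elements. -/
noncomputable def select {ι : Type*} (s : Finset ι) (k : ℕ) : Finset ι :=
  (Finset.exists_subset_card_eq (min_le_right k s.card)).choose

theorem select_subset {ι : Type*} (s : Finset ι) (k : ℕ) : select s k ⊆ s :=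
  (Finset.exists_subset_card_eq (min_le_right k s.card)).choose_spec.1

theorem card_select {ι : Type*} (s : Finset ι) (k : ℕ) : (select s k).card = min k s.card :=
  (Finset.exists_subset_card_eq (min_le_right k s.card)).choose_spec.2

theorem card_select_le {ι : Type*} (s : Finset ι) (k : ℕ) : (select s k).card ≤ k :=
  (card_select s k).trans_le (min_le_left _ _)

/-- The source of all saturation arguments: a candidate is left out only if the selection is full.
-/
theorem card_select_of_notMem {ι : Type*} {s : Finset ι} {k : ℕ} {i : ι} (hi : i ∈ s)
    (hi' : i ∉ select s k) : (select s k).card = k := by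
  rcases le_total k s.card with h | h
  · rw [card_select, min_eq_left h]
  · have : select s k = s :=
      Finset.eq_of_subset_of_card_le (select_subset s k) (by rw [card_select, min_eq_right h])
    exact absurd (this.symm ▸ hi : i ∈ select s k) hi'

/-- The local variables of a node of degree `d`. The orientation of the edge at a port is
`some true` if it is directed towards the node, `some false` if it is directed away from the node
and `none` if it is not fixed yet. -/
structure Node (d : ℕ) where
  inU : Bool
  θ : Fin d → ℝ
  α : ℕ
  status : Fin d → Option Bool
  level : ℕ
  avail : Fin d → Prop
  mem : Fin d → ℕ

namespace Node

variable {d : ℕ} (s : Node d)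

/-- The number of edges directed towards the node. -/
def load : ℕ := (Finset.univ.filter fun i => s.status i = some true).card

/-- The number of incident edges without orientation. -/
def free : ℕ := (Finset.univ.filter fun i => s.status i = none).card

/-- Whether the edge at port `i` prefers to be directed towards the node, given that the load of
the neighbor is in the memory. -/
def ToMe (i : Fin d) : Prop :=
  -- Ties go to the `V` side, so each edge prefers exactly one end.
  if s.inU then (s.load : ℝ) - ((s.mem i).unpair.1 : ℝ) < s.θ i
  else (s.load : ℝ) - ((s.mem i).unpair.1 : ℝ) ≤ s.θ i

open Classical in
/-- The ports of the edges that propose to the node. -/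
noncomputable def proposals (D : ℕ) : Finset (Fin d) :=
  Finset.univ.filter fun i =>
    s.status i = none ∧ D + 1 < s.free + (s.mem i).unpair.2 ∧ s.ToMe i

/-- The ports of the proposing edges that are directed towards the node. -/
noncomputable def accepted (D k : ℕ) : Finset (Fin d) := select (s.proposals D) k

/-- The edges that may be reversed in the current phase. -/
def Tight (i : Fin d) : Prop :=
  (s.status i = some true ∧ s.θ i ≤ (s.load : ℝ) - ((s.mem i).unpair.1 : ℝ)) ∨
  (s.status i = some false ∧ (s.load : ℝ) - ((s.mem i).unpair.1 : ℝ) ≤ s.θ i)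

/-- Active nodes are ready to give away tokens. -/
def Active (δ : ℕ) : Prop := s.level + s.α + δ ≤ s.load

open Classical in
/-- The ports through which a token is requested. -/
noncomputable def requests (δ : ℕ) : Finset (Fin d) :=
  if s.Active δ then ∅ else
    select (Finset.univ.filter fun i => s.avail i ∧ s.status i = some false ∧ s.mem i = 1) s.α

/-- The ports through which a token is given away. -/
noncomputable def grants : Finset (Fin d) :=
  select (Finset.univ.filter fun i => s.mem i = 1) s.α

theorem load_le : s.load ≤ d := by
  simpa [load] using Finset.card_le_univ (Finset.univ.filter fun i => s.status i = some true)

theorem free_le : s.free ≤ d := by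
  simpa [free] using Finset.card_le_univ (Finset.univ.filter fun i => s.status i = none)

end Node

/-- The kinds of communication rounds. -/
inductive Kind where
  | announce
  | accept (D k : ℕ)
  | probe (δ : ℕ)
  | request (δ : ℕ)
  | grant (δ : ℕ)

namespace Kind

open Classical in
/-- The message sent through port `i`. -/
noncomputable def send {d : ℕ} : Kind → Node d → Fin d → ℕ
  | announce, s, _ => Nat.pair s.load s.free
  | accept D k, s, i => if i ∈ s.accepted D k then 1 else 0
  | probe δ, s, _ => if s.Active δ then 1 else 0
  | request δ, s, i => if i ∈ s.requests δ then 1 else 0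
  | grant _, s, i => if i ∈ s.grants then 1 else 0

open Classical in
/-- The new local variables, given the received messages. -/
noncomputable def update {d : ℕ} : Kind → Node d → (Fin d → ℕ) → Node d
  | announce, s, m => { s with mem := m }
  | accept D k, s, m =>
    { s with
      status := fun i => if i ∈ s.accepted D k then some true
        else if m i = 1 then some false else s.status i
      -- Level and availability refer to the state before the acceptances; newly accepted edges are
      -- not available.
      level := s.load
      avail := s.Tight }
  | probe _, s, m => { s with mem := m }
  | request _, s, m => { s with mem := m }
  | grant δ, s, m =>
    { s with
      status := fun i => if i ∈ s.grants then some false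
        else if m i = 1 then some true else s.status i
      level := if s.Active δ then s.level + δ else s.level
      avail := fun i => s.avail i ∧ i ∉ s.grants ∧ m i ≠ 1 }

/-- Both counters are at most `d < n`, so their pairing stays below `n ^ 2`; all other messages are
0 or 1. -/
theorem send_lt {d n : ℕ} (K : Kind) (s : Node d) (i : Fin d) (h : d < n) :
    K.send s i < n ^ 2 := by
  have hn : 1 < n ^ 2 := by
    have := i.pos
    nlinarith
  cases K with
  | announce =>
    refine (Nat.pair_lt_max_add_one_sq _ _).trans_le (Nat.pow_le_pow_left ?_ 2)
    have := s.load_le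
    have := s.free_le
    omega
  | _ => simp only [send]; split_ifs <;> omega

end Kind

/-- The number with the given binary digits. -/
def decode (l : List Bool) : ℕ := l.foldr Nat.bit 0

theorem decode_bits (n : ℕ) : decode n.bits = n := by
  induction n using Nat.binaryRec' with
  | zero => simp [decode]
  | bit b n h ih => rw [Nat.bits_append_bit n b h, decode, List.foldr_cons, ← decode, ih]

/-- The global parameters of a run: `S` is the number of token steps in each of the `L` phases,
`D` bounds the degrees of the edges that are not yet oriented, and `Q` controls the granularity
of token transfers. -/
structure Schedule where
  Q : ℕ
  S : ℕ
  L : ℕ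
  D : ℕ → ℕ

namespace Schedule

variable (σ : Schedule)

/-- The maximum number of edges that a node accepts in a phase. -/
def quota (φ : ℕ) : ℕ := σ.D φ - σ.D (φ + 1)

/-- The amount by which the level of an active node increases. -/
def increment (φ : ℕ) : ℕ := σ.quota φ / σ.S + 1

/-- The three rounds of a token step. -/
def tokenStep (δ : ℕ) : List Kind := [.probe δ, .request δ, .grant δ]

/-- `T` token steps. -/
def tokenSteps (δ : ℕ) : ℕ → List Kind
  | 0 => []
  | T + 1 => tokenSteps δ T ++ tokenStep δ

/-- The rounds of one phase. -/
def phase (φ : ℕ) : List Kind :=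
  [.announce, .accept (σ.D (φ + 1)) (σ.quota φ)] ++ tokenSteps (σ.increment φ) σ.S

/-- The rounds of the first `L` phases. -/
def phases : ℕ → List Kind
  | 0 => []
  | L + 1 => phases L ++ σ.phase L

theorem length_tokenSteps (δ T : ℕ) : (tokenSteps δ T).length = 3 * T := by
  induction T with
  | zero => rfl
  | succ T ih => simp [tokenSteps, tokenStep, ih]; ring

theorem length_phases (L : ℕ) : (σ.phases L).length = L * (3 * σ.S + 2) := by
  induction L with
  | zero => simp [phases]
  | succ L ih => simp [phases, phase, ih, length_tokenSteps]; ring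

end Schedule

/-- The initial local variables of a node. -/
noncomputable def Node.ofInput (Q : ℕ) (I : NodeInput) : Node I.degree where
  inU := I.inU
  θ := fun i => if I.inU then -I.η i else I.η i
  -- This makes the degree less than `Q * α`, so `Q` full batches would exceed the incident edges.
  α := I.degree / Q + 1
  status := fun _ => none
  level := 0
  avail := fun _ => False
  mem := fun _ => 0

open Classical in
/-- The algorithm that runs a given schedule. An edge that is not oriented after
the last phase is oriented according to the sign of its parameter. -/
noncomputable def Schedule.algorithm (σ : Params → Schedule) : Algorithm where
  State d := Node d × List Kind
  init I := (Node.ofInput (σ I.params).Q I, (σ I.params).phases (σ I.params).L)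
  send s i := (s.2.head?.elim 0 fun K => K.send s.1 i).bits
  update s m := (s.2.head?.elim s.1 fun K => K.update s.1 fun i => decode (m i), s.2.tail)
  rounds p := ((σ p).phases (σ p).L).length
  output s i := (s.1.status i).getD (if s.1.inU then s.1.θ i > 0 else 0 ≤ s.1.θ i)

/-! ### Runs of the schedule on a network. -/

namespace Network

variable {V : Type*} [Fintype V] {G : SimpleGraph V} [DecidableRel G.Adj] (N : Network G)

/-- The local variables of all nodes after a round. -/
noncomputable def step (K : Kind) (c : ∀ v, Node (G.degree v)) (v : V) : Node (G.degree v) :=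
  K.update (c v) fun i => K.send (c (N.neighbor v i)) (N.backPort v i)

/-- The local variables of all nodes after several rounds. -/
noncomputable def run (l : List Kind) (c : ∀ v, Node (G.degree v)) : ∀ v, Node (G.degree v) :=
  l.foldl (fun c K => N.step K c) c

theorem run_append (l l' : List Kind) (c : ∀ v, Node (G.degree v)) :
    N.run (l ++ l') c = N.run l' (N.run l c) := by
  simp [run]

/-- The initial local variables. -/
noncomputable def start (Q : ℕ) (ε : ℝ) (v : V) : Node (G.degree v) :=
  Node.ofInput Q (N.nodeInput ε v)

theorem state_algorithm (σ : Params → Schedule) (ε : ℝ) (t : ℕ) (v : V) :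
    N.state (Schedule.algorithm σ) ε t v =
      (N.run (((σ (N.params ε)).phases (σ (N.params ε)).L).take t) (N.start (σ (N.params ε)).Q ε) v,
        ((σ (N.params ε)).phases (σ (N.params ε)).L).drop t) := by
  induction t generalizing v with
  | zero => rfl
  | succ t ih =>
    simp only [state, ih]
    generalize (σ (N.params ε)).phases (σ (N.params ε)).L = l
    simp only [Schedule.algorithm, decode_bits, List.tail_drop, List.head?_drop]
    congr 1
    rcases lt_or_ge t l.length with h | h
    · rw [List.take_succ_eq_append_getElem h, run_append]
      simp [List.getElem?_eq_getElem h, run, step]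
    · rw [List.getElem?_eq_none h, List.take_of_length_le h, List.take_of_length_le (by omega)]
      rfl

theorem messagesBounded_algorithm (σ : Params → Schedule) (ε : ℝ) :
    N.MessagesBounded (Schedule.algorithm σ) ε (2 * Nat.clog 2 (Fintype.card V)) := by
  intro t _ v i
  rw [state_algorithm]
  simp only [Schedule.algorithm, Nat.size_eq_bits_len, Nat.size_le, List.head?_drop]
  have hn : Fintype.card V ^ 2 ≤ 2 ^ (2 * Nat.clog 2 (Fintype.card V)) := by
    rw [mul_comm, pow_mul]
    exact Nat.pow_le_pow_left (Nat.le_pow_clog one_lt_two _) 2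
  refine lt_of_lt_of_le ?_ hn
  cases ((σ (N.params ε)).phases (σ (N.params ε)).L)[t]? with
  | none =>
    have := Fintype.card_pos_iff.mpr ⟨v⟩
    simp only [Option.elim_none]
    positivity
  | some K => exact K.send_lt _ _ (G.degree_lt_card_verts v)

theorem neighbor_port {v w : V} (h : G.Adj v w) : N.neighbor v (N.port v ⟨w, h⟩) = w := by
  simp [neighbor]

theorem apply_backPort {β : Type*} (f : (u : V) → Fin (G.degree u) → β) {v w : V} (h : G.Adj v w) :
    f (N.neighbor v (N.port v ⟨w, h⟩)) (N.backPort v (N.port v ⟨w, h⟩)) =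
      f w (N.port w ⟨v, h.symm⟩) := by
  -- The neighbor occurs in the types of the ports; generalizing to `z` permits substitution.
  have key : ∀ z : G.neighborSet v, z = ⟨w, h⟩ →
      f z.1 (N.port z.1 ⟨v, (z.2 : G.Adj v z).symm⟩) = f w (N.port w ⟨v, h.symm⟩) := by
    rintro _ rfl
    rfl
  exact key _ ((N.port v).symm_apply_apply _)

/-- The set of neighbors of `v` at the given ports. -/
def nodes (v : V) (s : Finset (Fin (G.degree v))) : Finset V :=
  s.map ((N.port v).symm.toEmbedding.trans (Function.Embedding.subtype _))

theorem card_nodes (v : V) (s : Finset (Fin (G.degree v))) : (N.nodes v s).card = s.card :=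
  Finset.card_map _

theorem mem_nodes {v w : V} {s : Finset (Fin (G.degree v))} :
    w ∈ N.nodes v s ↔ ∃ h : G.Adj v w, N.port v ⟨w, h⟩ ∈ s := by
  simp only [nodes, Finset.mem_map, Function.Embedding.trans_apply, Equiv.coe_toEmbedding,
    Function.Embedding.subtype_apply]
  constructor
  · rintro ⟨i, hi, rfl⟩
    exact ⟨((N.port v).symm i).2, by simpa using hi⟩
  · rintro ⟨h, hi⟩
    exact ⟨_, hi, by simp⟩

theorem mem_nodes_of_adj {v w : V} (h : G.Adj v w) {s : Finset (Fin (G.degree v))} :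
    w ∈ N.nodes v s ↔ N.port v ⟨w, h⟩ ∈ s := by
  rw [mem_nodes]
  exact ⟨fun ⟨_, h⟩ => h, fun h' => ⟨h, h'⟩⟩

end Network

/-! ### The token game in the abstract. -/

/-- A run of the token game. At time `t` the node `v` holds `X t v` tokens and has the level
`h t v`; `E t a b` says that a token may be moved from `a` to `b`; `R t b` is the set of nodes from
which `b` requests a token, and `P t a` is the set of nodes to which `a` passes a token. -/
structure IsTokenRun {V : Type*} [Fintype V] [DecidableEq V] (α : V → ℕ) (δ : ℕ)
    (X h : ℕ → V → ℕ) (E : ℕ → V → V → Prop) (R P : ℕ → V → Finset V) : Prop where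
  request_inactive : ∀ t b, h t b + α b + δ ≤ X t b → R t b = ∅
  edge_of_request : ∀ t b, ∀ a ∈ R t b, E t a b
  active_of_request : ∀ t b, ∀ a ∈ R t b, h t a + α a + δ ≤ X t a
  card_request_le : ∀ t b, (R t b).card ≤ α b
  card_request : ∀ t a b, E t a b → h t a + α a + δ ≤ X t a → ¬ h t b + α b + δ ≤ X t b →
    a ∉ R t b → (R t b).card = α b
  request_of_pass : ∀ t a, ∀ b ∈ P t a, a ∈ R t b
  card_pass_le : ∀ t a, (P t a).card ≤ α a
  card_pass : ∀ t a b, a ∈ R t b → b ∉ P t a → (P t a).card = α a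
  edge_succ : ∀ t a b, E (t + 1) a b ↔ E t a b ∧ b ∉ P t a
  level_succ : ∀ t v, h (t + 1) v = if h t v + α v + δ ≤ X t v then h t v + δ else h t v
  tokens_succ : ∀ t v, X (t + 1) v + (P t v).card =
    X t v + (Finset.univ.filter fun a => v ∈ P t a).card

namespace IsTokenRun

variable {V : Type*} [Fintype V] [DecidableEq V] {α : V → ℕ} {δ : ℕ}
  {X h : ℕ → V → ℕ} {E : ℕ → V → V → Prop} {R P : ℕ → V → Finset V}
  (H : IsTokenRun α δ X h E R P)

include H

theorem level_le_succ (t : ℕ) (v : V) : h t v ≤ h (t + 1) v := by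
  rw [H.level_succ]; split_ifs <;> omega

theorem level_succ_le (t : ℕ) (v : V) : h (t + 1) v ≤ h t v + δ := by
  rw [H.level_succ]; split_ifs <;> omega

theorem level_mono (v : V) : Monotone fun t => h t v :=
  monotone_nat_of_le_succ fun t => H.level_le_succ t v

theorem level_le (t : ℕ) (v : V) : h t v ≤ h 0 v + t * δ := by
  induction t with
  | zero => simp
  | succ t ih => have := H.level_succ_le t v; rw [add_mul]; omega

theorem pass_eq_empty {t : ℕ} {v : V} (hv : ¬ h t v + α v + δ ≤ X t v) : P t v = ∅ := by
  refine Finset.eq_empty_of_forall_notMem fun b hb => hv ?_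
  exact H.active_of_request t b v (H.request_of_pass t v b hb)

theorem card_received_le (t : ℕ) (v : V) :
    (Finset.univ.filter fun a => v ∈ P t a).card ≤ (R t v).card :=
  Finset.card_le_card fun a ha => H.request_of_pass t a v (Finset.mem_filter.mp ha).2

/-- An active node has `α + δ` tokens above its level, passes at most `α` and rises by `δ`; an
inactive one passes nothing. -/
theorem level_le_tokens (h0 : ∀ v, h 0 v ≤ X 0 v) (t : ℕ) (v : V) : h t v ≤ X t v := by
  induction t with
  | zero => exact h0 v
  | succ t ih =>
    have h1 := H.tokens_succ t v
    have h2 := H.card_pass_le t v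
    have h3 := H.level_succ t v
    split_ifs at h3 with ha
    · omega
    · have := H.pass_eq_empty ha
      simp only [this, Finset.card_empty] at h1
      omega

/-- An active node receives nothing, so its surplus over the level falls by at least `δ`. An
inactive node has surplus below `α + δ` and gains at most `α`. The second alternative covers a
surplus that has been falling since the start. -/
theorem tokens_le {k : ℕ} (h0 : ∀ v, X 0 v ≤ h 0 v + k) (t : ℕ) (v : V) :
    X t v ≤ h t v + 2 * α v + δ ∨ X t v + t * δ ≤ h t v + k := by
  induction t with
  | zero => right; simpa using h0 v
  | succ t ih =>
    have h1 := H.tokens_succ t v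
    have h2 := H.card_received_le t v
    have h3 := H.level_succ t v
    split_ifs at h3 with ha
    · rw [H.request_inactive t v ha, Finset.card_empty] at h2
      rw [add_mul]
      omega
    · have := H.card_request_le t v
      omega

theorem edge_of_le {s t : ℕ} (hst : s ≤ t) {a b : V} (he : E t a b) : E s a b := by
  induction hst with
  | refl => exact he
  | step _ ih => exact ih ((H.edge_succ _ a b).mp he).1

theorem pass_eq {s t : ℕ} {a b : V} (hs : b ∈ P s a) (ht : b ∈ P t a) : s = t := by
  have key : ∀ s t, s < t → b ∈ P s a → b ∉ P t a := fun s t hst hs ht => by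
    have := H.edge_of_le hst (H.edge_of_request t b a (H.request_of_pass t a b ht))
    exact ((H.edge_succ s a b).mp this).2 hs
  rcases lt_trichotomy s t with h | h | h
  · exact absurd ht (key s t h hs)
  · exact h
  · exact absurd hs (key t s h ht)

/-- A pair carries a token at most once, so the sets `P t a` are disjoint inside `B`, and each
saturated time uses up `α a` elements. -/
theorem card_saturated_le {Q : ℕ} {a : V} {B : Finset V} (hB : B.card < Q * α a)
    (hE : ∀ b, E 0 a b → b ∈ B) (T : ℕ) :
    ((Finset.range T).filter fun t => (P t a).card = α a).card ≤ Q := by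
  have h1 : ((Finset.range T).filter fun t => (P t a).card = α a).card * α a ≤ B.card := by
    rw [← smul_eq_mul, ← Finset.sum_const]
    calc _ = ∑ t ∈ (Finset.range T).filter fun t => (P t a).card = α a, (P t a).card :=
          Finset.sum_congr rfl fun t ht => (Finset.mem_filter.mp ht).2.symm
      _ = (((Finset.range T).filter fun t => (P t a).card = α a).biUnion fun t => P t a).card := by
          rw [Finset.card_biUnion]
          intro s _ t _ hst
          rw [Function.onFun, Finset.disjoint_left]
          exact fun b hs ht => hst (H.pass_eq hs ht)
      _ ≤ B.card := by
          refine Finset.card_le_card fun b hb => ?_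
          obtain ⟨t, _, ht⟩ := Finset.mem_biUnion.mp hb
          exact hE b (H.edge_of_le t.zero_le (H.edge_of_request t b a (H.request_of_pass t a b ht)))
  exact (lt_of_mul_lt_mul_right (h1.trans_lt hB) (Nat.zero_le _)).le

/-- A request is either granted, at most once, or refused, and then `a` is saturated. -/
theorem card_requests_le {Q : ℕ} {a b : V}
    (hQ : ∀ T, ((Finset.range T).filter fun t => (P t a).card = α a).card ≤ Q) (T : ℕ) :
    ((Finset.range T).filter fun t => a ∈ R t b).card ≤ Q + 1 := by
  have hsub : (Finset.range T).filter (fun t => a ∈ R t b) ⊆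
      ((Finset.range T).filter fun t => (P t a).card = α a) ∪
        (Finset.range T).filter fun t => b ∈ P t a := by
    intro t ht
    simp only [Finset.mem_union, Finset.mem_filter] at ht ⊢
    by_cases hb : b ∈ P t a
    · exact Or.inr ⟨ht.1, hb⟩
    · exact Or.inl ⟨ht.1, H.card_pass t a b ht.2 hb⟩
  refine (Finset.card_le_card hsub).trans ((Finset.card_union_le _ _).trans
    (Nat.add_le_add (hQ T) (Finset.card_le_one.mpr ?_)))
  intro s hs t ht
  exact H.pass_eq (Finset.mem_filter.mp hs).2 (Finset.mem_filter.mp ht).2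

/-- Double counting of the requests of `b`: each of fewer than `Q * α b` nodes is asked at most `Q +
1` times, and a full time spends `α b` requests. -/
theorem card_full_requests_le {Q : ℕ} {b : V} {B : Finset V} (hB : B.card < Q * α b)
    (hE : ∀ a, E 0 a b → a ∈ B)
    (hQ : ∀ a T, ((Finset.range T).filter fun t => (P t a).card = α a).card ≤ Q) (T : ℕ) :
    ((Finset.range T).filter fun t => (R t b).card = α b).card ≤ Q * (Q + 1) := by
  have h1 : ((Finset.range T).filter fun t => (R t b).card = α b).card * α b ≤
      B.card * (Q + 1) := by
    rw [← smul_eq_mul, ← Finset.sum_const]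
    calc _ = ∑ t ∈ (Finset.range T).filter fun t => (R t b).card = α b, (R t b).card :=
          Finset.sum_congr rfl fun t ht => (Finset.mem_filter.mp ht).2.symm
      _ ≤ ∑ t ∈ Finset.range T, (R t b).card :=
          Finset.sum_le_sum_of_subset (Finset.filter_subset _ _)
      _ = ∑ t ∈ Finset.range T, (B.filter fun a => a ∈ R t b).card := by
          refine Finset.sum_congr rfl fun t _ => congrArg _ ?_
          ext a
          simp only [Finset.mem_filter, iff_and_self]
          exact fun ha => hE a (H.edge_of_le t.zero_le (H.edge_of_request t b a ha))
      _ = ∑ a ∈ B, ((Finset.range T).filter fun t => a ∈ R t b).card :=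
          Finset.sum_card_bipartiteAbove_eq_sum_card_bipartiteBelow _
      _ ≤ ∑ _a ∈ B, (Q + 1) := Finset.sum_le_sum fun a _ => H.card_requests_le (hQ a) T
      _ = B.card * (Q + 1) := by simp
  have h2 : B.card * (Q + 1) < Q * (Q + 1) * α b := by
    calc _ < Q * α b * (Q + 1) := Nat.mul_lt_mul_of_pos_right hB (Nat.succ_pos _)
      _ = _ := by ring
  exact (lt_of_mul_lt_mul_right (h1.trans_lt h2) (Nat.zero_le _)).le

/-- The levels of two nodes cannot drift apart while an edge between them is unused. -/
theorem level_sub_le {Q : ℕ} {B : V → Finset V} (hB : ∀ v, (B v).card < Q * α v)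
    (hE : ∀ a b, E 0 a b → b ∈ B a) (hE' : ∀ a b, E 0 a b → a ∈ B b) {T : ℕ} {a b : V}
    (he : E T a b) : h T a + h 0 b ≤ h 0 a + h T b + δ * (Q * (Q + 2)) := by
  have hQ : ∀ a T, ((Finset.range T).filter fun t => (P t a).card = α a).card ≤ Q :=
    fun a T => H.card_saturated_le (hB a) (hE a) T
  have hR := H.card_full_requests_le (hB b) (fun a => hE' a b) hQ T
  -- The gap grows only if `a` is active and `b` is not. As the edge stays unused, either `a`
  -- refused `b` or `b` did not ask `a`; one of them is saturated.
  have hdrift : ∀ t ≤ T, h t a + h 0 b ≤ h 0 a + h t b +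
      δ * (Nat.count (fun t => (P t a).card = α a) t +
        Nat.count (fun t => (R t b).card = α b) t) := by
    intro t ht
    induction t with
    | zero => simp
    | succ t ih =>
      specialize ih (by omega)
      obtain ⟨he', hP⟩ := (H.edge_succ t a b).mp (H.edge_of_le ht he)
      rw [Nat.count_succ, Nat.count_succ]
      have hstep : h (t + 1) a + h t b ≤ h t a + h (t + 1) b +
          δ * ((if (P t a).card = α a then 1 else 0) + if (R t b).card = α b then 1 else 0) := by
        rw [H.level_succ t a, H.level_succ t b]
        by_cases h1 : h t a + α a + δ ≤ X t a ∧ ¬ h t b + α b + δ ≤ X t b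
        · have hcase : (P t a).card = α a ∨ (R t b).card = α b := by
            by_cases hr : a ∈ R t b
            · exact Or.inl (H.card_pass t a b hr hP)
            · exact Or.inr (H.card_request t a b he' h1.1 h1.2 hr)
          rw [if_pos h1.1, if_neg h1.2]
          have : 1 ≤ (if (P t a).card = α a then 1 else 0) +
              if (R t b).card = α b then 1 else 0 := by
            rcases hcase with hc | hc <;> rw [if_pos hc] <;> omega
          nlinarith
        · have : (if h t a + α a + δ ≤ X t a then h t a + δ else h t a) + h t b ≤
              h t a + if h t b + α b + δ ≤ X t b then h t b + δ else h t b := by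
            split_ifs <;> omega
          omega
      have : ∀ x y x' y' : ℕ, δ * (x + x' + (y + y')) = δ * (x + y) + δ * (x' + y') := by
        intros; ring
      rw [this]
      omega
  -- The saturated times number at most `Q + Q(Q+1) = Q(Q+2)`.
  refine (hdrift T le_rfl).trans (Nat.add_le_add_left (Nat.mul_le_mul_left δ ?_) _)
  have := hQ a T
  simp only [Nat.count_eq_card_filter_range]
  nlinarith

end IsTokenRun

/-! ### Node states read edge by edge. -/

namespace Network

variable {V : Type*} [Fintype V] {G : SimpleGraph V} [DecidableRel G.Adj] (N : Network G)

/-- The orientation of the edge `{v, w}` according to `v`. -/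
noncomputable def stat (c : ∀ v, Node (G.degree v)) (v w : V) : Option Bool :=
  if h : G.Adj v w then (c v).status (N.port v ⟨w, h⟩) else none

/-- Whether the edge `{v, w}` may be reversed in the current phase according to `v`. -/
def avl (c : ∀ v, Node (G.degree v)) (v w : V) : Prop :=
  ∃ h : G.Adj v w, (c v).avail (N.port v ⟨w, h⟩)

/-- The edge parameter from the perspective of the node `v`. -/
noncomputable def theta (v w : V) : ℝ := if N.side v then -N.η s(v, w) else N.η s(v, w)

/-- The constant part of the local variables. -/
def Static (Q : ℕ) (c : ∀ v, Node (G.degree v)) : Prop :=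
  ∀ v, (c v).inU = N.side v ∧ (c v).α = G.degree v / Q + 1 ∧
    (c v).θ = fun i => N.theta v (N.neighbor v i)

/-- The two endpoints of every edge agree on its orientation. -/
def Consistent (c : ∀ v, Node (G.degree v)) : Prop :=
  ∀ v w, G.Adj v w → N.stat c w v = (N.stat c v w).map not

variable {N} {c : ∀ v, Node (G.degree v)}

theorem theta_symm {v w : V} (h : G.Adj v w) : N.theta w v = -N.theta v w := by
  have h' : N.side v ≠ N.side w := N.side.valid h
  have hs : s(w, v) = s(v, w) := Sym2.eq_swap
  unfold theta
  rw [hs]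
  cases hv : N.side v <;> cases hw : N.side w <;> simp_all

theorem stat_of_adj {v w : V} (h : G.Adj v w) :
    N.stat c v w = (c v).status (N.port v ⟨w, h⟩) := dif_pos h

theorem stat_of_not_adj {v w : V} (h : ¬ G.Adj v w) : N.stat c v w = none := dif_neg h

theorem adj_of_stat {v w : V} {b : Bool} (h : N.stat c v w = some b) : G.Adj v w := by
  by_contra h'
  rw [stat_of_not_adj h'] at h
  exact Option.some_ne_none b h.symm

theorem Consistent.some_iff (hc : N.Consistent c) {v w : V} {b : Bool} :
    N.stat c v w = some b ↔ N.stat c w v = some (!b) := by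
  have key : ∀ v w b, N.stat c v w = some b → N.stat c w v = some (!b) := by
    intro v w b h
    rw [hc v w (adj_of_stat h), h]
    rfl
  exact ⟨key v w b, fun h => by simpa using key w v _ h⟩

theorem Consistent.none_iff (hc : N.Consistent c) {v w : V} (h : G.Adj v w) :
    N.stat c v w = none ↔ N.stat c w v = none := by
  rw [hc v w h, Option.map_eq_none_iff]

open Classical in
theorem load_eq (v : V) :
    (c v).load = (Finset.univ.filter fun w => N.stat c v w = some true).card := by
  rw [Node.load, ← N.card_nodes]
  congr 1
  ext w
  rw [mem_nodes]
  simp only [Finset.mem_filter, Finset.mem_univ, true_and]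
  exact ⟨fun ⟨h, hs⟩ => (stat_of_adj h).trans hs,
    fun h => ⟨adj_of_stat h, (stat_of_adj (adj_of_stat h)).symm.trans h⟩⟩

open Classical in
theorem free_eq (v : V) :
    (c v).free = (Finset.univ.filter fun w => G.Adj v w ∧ N.stat c v w = none).card := by
  rw [Node.free, ← N.card_nodes]
  congr 1
  ext w
  rw [mem_nodes]
  simp only [Finset.mem_filter, Finset.mem_univ, true_and]
  exact ⟨fun ⟨h, hs⟩ => ⟨h, (stat_of_adj h).trans hs⟩,
    fun h => ⟨h.1, (stat_of_adj h.1).symm.trans h.2⟩⟩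

theorem Static.step {Q : ℕ} (hc : N.Static Q c) (K : Kind) : N.Static Q (N.step K c) := by
  intro v
  cases K <;> exact hc v

theorem Static.run {Q : ℕ} (hc : N.Static Q c) (l : List Kind) : N.Static Q (N.run l c) := by
  induction l generalizing c with
  | nil => exact hc
  | cons K l ih => exact ih (hc.step K)

theorem Static.theta {Q : ℕ} (hc : N.Static Q c) {v w : V} (h : G.Adj v w) :
    (c v).θ (N.port v ⟨w, h⟩) = N.theta v w := by
  rw [(hc v).2.2]
  simp only [neighbor_port]

variable (N) in
theorem message {K : Kind} {v w : V} (h : G.Adj v w) :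
    (K.send (c (N.neighbor v (N.port v ⟨w, h⟩))) (N.backPort v (N.port v ⟨w, h⟩))) =
      K.send (c w) (N.port w ⟨v, h.symm⟩) :=
  N.apply_backPort (fun u i => K.send (c u) i) h

/-! ### Acceptance of new edges. -/

section Accept

variable (N) (c) (D k : ℕ)

/-- The set of neighbors `w` such that the edge `{v, w}` is accepted by `v`. -/
noncomputable def acceptedNodes (v : V) : Finset V :=
  N.nodes v ((N.step .announce c v).accepted D k)

variable {N c D k}

theorem mem_announce {v w : V} (h : G.Adj v w) :
    (N.step .announce c v).mem (N.port v ⟨w, h⟩) = Nat.pair (c w).load (c w).free :=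
  N.message (K := .announce) (c := c) h

theorem mem_proposals {Q : ℕ} (hc : N.Static Q c) {v w : V} (h : G.Adj v w) :
    N.port v ⟨w, h⟩ ∈ (N.step .announce c v).proposals D ↔
      N.stat c v w = none ∧ D + 1 < (c v).free + (c w).free ∧
        if N.side v then ((c v).load : ℝ) - (c w).load < N.theta v w
        else ((c v).load : ℝ) - (c w).load ≤ N.theta v w := by
  have h1 : (N.step .announce c v).θ (N.port v ⟨w, h⟩) = N.theta v w := (hc.step _).theta h
  have h2 : (N.step .announce c v).inU = N.side v := ((hc.step _) v).1
  have h3 : (N.step .announce c v).load = (c v).load := rfl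
  have h4 : (N.step .announce c v).free = (c v).free := rfl
  have h5 : (N.step .announce c v).status = (c v).status := rfl
  simp only [Node.proposals, Finset.mem_filter, Node.ToMe, mem_announce, h1, h2, h3, h4, h5,
    stat_of_adj h, Nat.unpair_pair, Finset.mem_univ, true_and]

theorem of_mem_acceptedNodes {Q : ℕ} (hc : N.Static Q c) {v w : V}
    (hw : w ∈ N.acceptedNodes c D k v) :
    G.Adj v w ∧ N.stat c v w = none ∧ D + 1 < (c v).free + (c w).free ∧
      ((c v).load : ℝ) - (c w).load ≤ N.theta v w := by
  obtain ⟨h, hw⟩ := N.mem_nodes.mp hw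
  obtain ⟨h1, h2, h3⟩ := (mem_proposals hc h).mp (select_subset _ _ hw)
  refine ⟨h, h1, h2, ?_⟩
  split_ifs at h3
  · exact h3.le
  · exact h3

/-- `theta` is antisymmetric and the comparison is strict on one side only, so the preferences of
the two ends exclude each other. -/
theorem notMem_acceptedNodes {Q : ℕ} (hc : N.Static Q c) {v w : V}
    (hw : w ∈ N.acceptedNodes c D k v) : v ∉ N.acceptedNodes c D k w := by
  intro hv
  obtain ⟨h, hw⟩ := N.mem_nodes.mp hw
  obtain ⟨h', hv⟩ := N.mem_nodes.mp hv
  obtain ⟨_, _, h1⟩ := (mem_proposals hc h).mp (select_subset _ _ hw)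
  obtain ⟨_, _, h2⟩ := (mem_proposals hc h').mp (select_subset _ _ hv)
  rw [theta_symm h] at h2
  have hs : N.side v ≠ N.side w := N.side.valid h
  cases hv : N.side v <;> cases hw : N.side w <;> simp only [hv, hw] at h1 h2 hs
  · exact hs rfl
  · simp at h1 h2; linarith
  · simp at h1 h2; linarith
  · exact hs rfl

theorem card_acceptedNodes_le (v : V) : (N.acceptedNodes c D k v).card ≤ k := by
  rw [acceptedNodes, card_nodes]
  exact card_select_le _ _

/-- The edge proposes to one of its ends, which rejects it only with its quota exhausted. -/
theorem card_acceptedNodes {Q : ℕ} (hc : N.Static Q c) (hs : N.Consistent c) {v w : V}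
    (h : G.Adj v w) (hn : N.stat c v w = none) (hD : D + 1 < (c v).free + (c w).free)
    (hw : w ∉ N.acceptedNodes c D k v) (hv : v ∉ N.acceptedNodes c D k w) :
    (N.acceptedNodes c D k v).card = k ∨ (N.acceptedNodes c D k w).card = k := by
  have key : N.port v ⟨w, h⟩ ∈ (N.step .announce c v).proposals D ∨
      N.port w ⟨v, h.symm⟩ ∈ (N.step .announce c w).proposals D := by
    rw [mem_proposals hc, mem_proposals hc, theta_symm h, ← hs.none_iff h]
    have hs : N.side v ≠ N.side w := N.side.valid h
    rw [add_comm (c w).free]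
    simp only [hn, hD, true_and]
    cases hv : N.side v <;> cases hw : N.side w
    · simp_all
    · simp only [Bool.false_eq_true, if_false, if_true]
      by_contra! h'
      linarith
    · simp only [Bool.false_eq_true, if_false, if_true]
      by_contra! h'
      linarith
    · simp_all
  simp only [acceptedNodes, card_nodes]
  rcases key with h' | h'
  · left
    exact card_select_of_notMem h' (fun hh => hw (N.mem_nodes.mpr ⟨h, hh⟩))
  · right
    exact card_select_of_notMem h' (fun hh => hv (N.mem_nodes.mpr ⟨h.symm, hh⟩))

variable (N c D k) in
/-- The local variables after the acceptance of new edges. -/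
noncomputable def afterAccept : ∀ v, Node (G.degree v) := N.run [.announce, .accept D k] c

open Classical in
theorem stat_afterAccept (v w : V) :
    N.stat (N.afterAccept c D k) v w = if w ∈ N.acceptedNodes c D k v then some true
      else if v ∈ N.acceptedNodes c D k w then some false else N.stat c v w := by
  by_cases h : G.Adj v w
  · have hm : Kind.send (.accept D k) (N.step .announce c (N.neighbor v (N.port v ⟨w, h⟩)))
        (N.backPort v (N.port v ⟨w, h⟩)) = 1 ↔ v ∈ N.acceptedNodes c D k w := by
      rw [N.message (K := .accept D k) (c := N.step .announce c) h, acceptedNodes,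
        mem_nodes_of_adj N h.symm]
      simp [Kind.send]
    have hw : w ∈ N.acceptedNodes c D k v ↔ _ := mem_nodes_of_adj N h
    simp only [stat_of_adj h, hw, ← hm]
    rfl
  · have h1 : w ∉ N.acceptedNodes c D k v := fun h' => h (N.mem_nodes.mp h').1
    have h2 : v ∉ N.acceptedNodes c D k w := fun h' => h (N.mem_nodes.mp h').1.symm
    rw [if_neg h1, if_neg h2, stat_of_not_adj h, stat_of_not_adj h]

theorem level_afterAccept (v : V) : (N.afterAccept c D k v).level = (c v).load := rfl

theorem avl_afterAccept {Q : ℕ} (hc : N.Static Q c) (v w : V) :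
    N.avl (N.afterAccept c D k) v w ↔
      (N.stat c v w = some true ∧ N.theta v w ≤ ((c v).load : ℝ) - (c w).load) ∨
      (N.stat c v w = some false ∧ ((c v).load : ℝ) - (c w).load ≤ N.theta v w) := by
  by_cases h : G.Adj v w
  · have h1 : (N.step .announce c v).θ (N.port v ⟨w, h⟩) = N.theta v w := (hc.step _).theta h
    have h3 : (N.step .announce c v).load = (c v).load := rfl
    have h5 : (N.step .announce c v).status = (c v).status := rfl
    have h6 : (N.afterAccept c D k v).avail = (N.step .announce c v).Tight := rfl
    have h7 : N.avl (N.afterAccept c D k) v w ↔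
        (N.afterAccept c D k v).avail (N.port v ⟨w, h⟩) := ⟨fun ⟨_, h⟩ => h, fun h' => ⟨h, h'⟩⟩
    rw [h7, h6, Node.Tight, h1, h3, h5, mem_announce, Nat.unpair_pair, stat_of_adj h]
  · simp only [stat_of_not_adj h]
    simp only [reduceCtorEq, false_and, or_self, iff_false]
    exact fun h' => h h'.1

end Accept

/-! ### One token step. -/

section TokenStep

variable (N) (c) (δ : ℕ)

/-- The set of neighbors from which `v` requests a token. -/
noncomputable def requestedNodes (v : V) : Finset V :=
  N.nodes v ((N.step (.probe δ) c v).requests δ)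

/-- The set of neighbors to which `v` passes a token. -/
noncomputable def passedNodes (v : V) : Finset V :=
  N.nodes v ((N.step (.request δ) (N.step (.probe δ) c) v).grants)

/-- The local variables after one token step. -/
noncomputable def afterToken : ∀ v, Node (G.degree v) := N.run (Schedule.tokenStep δ) c

variable {N c δ}

open Classical in
theorem mem_requestedNodes_aux (v w : V) :
    (∃ h : G.Adj v w, N.port v ⟨w, h⟩ ∈ Finset.univ.filter fun i =>
      (N.step (.probe δ) c v).avail i ∧ (N.step (.probe δ) c v).status i = some false ∧
        (N.step (.probe δ) c v).mem i = 1) ↔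
      N.avl c v w ∧ N.stat c v w = some false ∧ (c w).Active δ := by
  constructor
  · rintro ⟨h, hi⟩
    obtain ⟨h1, h2, h3⟩ := (Finset.mem_filter.mp hi).2
    refine ⟨⟨h, h1⟩, (stat_of_adj h).trans h2, ?_⟩
    have := (N.message (K := .probe δ) (c := c) h).symm.trans h3
    simpa [Kind.send] using this
  · rintro ⟨⟨h, h1⟩, h2, h3⟩
    refine ⟨h, Finset.mem_filter.mpr ⟨Finset.mem_univ _, h1, (stat_of_adj h).symm.trans h2, ?_⟩⟩
    refine (N.message (K := .probe δ) (c := c) h).trans ?_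
    simp [Kind.send, h3]

theorem requestedNodes_of_active {v : V} (h : (c v).Active δ) :
    N.requestedNodes c δ v = ∅ := by
  have h' : (N.step (.probe δ) c v).Active δ := h
  rw [requestedNodes, Node.requests, if_pos h']
  rfl

theorem of_mem_requestedNodes {v w : V} (hw : w ∈ N.requestedNodes c δ v) :
    N.avl c v w ∧ N.stat c v w = some false ∧ (c w).Active δ := by
  obtain ⟨h, hw⟩ := N.mem_nodes.mp hw
  rw [Node.requests] at hw
  split_ifs at hw
  · simp at hw
  · exact (mem_requestedNodes_aux v w).mp ⟨h, by convert select_subset _ _ hw⟩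

theorem alpha_le_card_requestedNodes {v w : V} (ha : N.avl c v w)
    (hs : N.stat c v w = some false) (hw : (c w).Active δ) (hv : ¬ (c v).Active δ)
    (hr : w ∉ N.requestedNodes c δ v) : (N.requestedNodes c δ v).card = (c v).α := by
  obtain ⟨h, hi⟩ := (mem_requestedNodes_aux v w).mpr ⟨ha, hs, hw⟩
  have hv' : ¬ (N.step (.probe δ) c v).Active δ := hv
  rw [requestedNodes, mem_nodes_of_adj N h] at hr
  rw [requestedNodes, card_nodes]
  rw [Node.requests, if_neg hv'] at hr ⊢
  refine card_select_of_notMem ?_ hr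
  convert hi

theorem card_requestedNodes_le (v : V) : (N.requestedNodes c δ v).card ≤ (c v).α := by
  rw [requestedNodes, card_nodes, Node.requests]
  split_ifs
  · simp
  · exact card_select_le _ _

theorem mem_request {v w : V} (h : G.Adj v w) :
    (N.step (.request δ) (N.step (.probe δ) c) v).mem (N.port v ⟨w, h⟩) = 1 ↔
      v ∈ N.requestedNodes c δ w := by
  have : (N.step (.request δ) (N.step (.probe δ) c) v).mem (N.port v ⟨w, h⟩) =
      Kind.send (.request δ) (N.step (.probe δ) c w) (N.port w ⟨v, h.symm⟩) :=
    N.message (K := .request δ) (c := N.step (.probe δ) c) h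
  rw [this, requestedNodes, mem_nodes_of_adj N h.symm]
  simp [Kind.send]

theorem mem_requestedNodes_of_mem_passedNodes {v w : V} (hw : w ∈ N.passedNodes c δ v) :
    v ∈ N.requestedNodes c δ w := by
  obtain ⟨h, hw⟩ := N.mem_nodes.mp hw
  exact (mem_request h).mp (Finset.mem_filter.mp (select_subset _ _ hw)).2

theorem card_passedNodes_le (v : V) : (N.passedNodes c δ v).card ≤ (c v).α := by
  rw [passedNodes, card_nodes]
  exact card_select_le _ _

theorem card_passedNodes {v w : V} (hv : v ∈ N.requestedNodes c δ w)
    (hw : w ∉ N.passedNodes c δ v) : (N.passedNodes c δ v).card = (c v).α := by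
  obtain ⟨h, _⟩ := N.mem_nodes.mp hv
  rw [passedNodes, mem_nodes_of_adj N h.symm] at hw
  rw [passedNodes, card_nodes]
  exact card_select_of_notMem
    (Finset.mem_filter.mpr ⟨Finset.mem_univ _, (mem_request h.symm).mpr hv⟩) hw

variable (N) in
theorem message_grant {v w : V} (h : G.Adj v w) :
    Kind.send (.grant δ) (N.step (.request δ) (N.step (.probe δ) c)
      (N.neighbor v (N.port v ⟨w, h⟩))) (N.backPort v (N.port v ⟨w, h⟩)) = 1 ↔
      v ∈ N.passedNodes c δ w := by
  rw [N.message (K := .grant δ) (c := N.step (.request δ) (N.step (.probe δ) c)) h, passedNodes,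
    mem_nodes_of_adj N h.symm]
  simp [Kind.send]

open Classical in
theorem stat_afterToken (v w : V) :
    N.stat (N.afterToken c δ) v w = if w ∈ N.passedNodes c δ v then some false
      else if v ∈ N.passedNodes c δ w then some true else N.stat c v w := by
  by_cases h : G.Adj v w
  · have h1 := N.message_grant (c := c) (δ := δ) h
    have hw : w ∈ N.passedNodes c δ v ↔ _ := mem_nodes_of_adj N h
    simp only [stat_of_adj h, hw, ← h1]
    rfl
  · have h1 : w ∉ N.passedNodes c δ v := fun h' => h (N.mem_nodes.mp h').1
    have h2 : v ∉ N.passedNodes c δ w := fun h' => h (N.mem_nodes.mp h').1.symm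
    rw [if_neg h1, if_neg h2, stat_of_not_adj h, stat_of_not_adj h]

theorem avl_afterToken (v w : V) :
    N.avl (N.afterToken c δ) v w ↔
      N.avl c v w ∧ w ∉ N.passedNodes c δ v ∧ v ∉ N.passedNodes c δ w := by
  constructor
  · rintro ⟨h, h1, h2, h3⟩
    refine ⟨⟨h, h1⟩, ?_, ?_⟩
    · rwa [passedNodes, mem_nodes_of_adj N h]
    · exact fun h' => h3 ((N.message_grant h).mpr h')
  · rintro ⟨⟨h, h1⟩, h2, h3⟩
    refine ⟨h, h1, ?_, ?_⟩
    · rwa [passedNodes, mem_nodes_of_adj N h] at h2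
    · exact fun h' => h3 ((N.message_grant h).mp h')

open Classical in
theorem level_afterToken (v : V) : (N.afterToken c δ v).level =
    if (c v).Active δ then (c v).level + δ else (c v).level := rfl

end TokenStep

end Network

/-! ### The token steps of a phase as a token game. -/

namespace Network

variable {V : Type*} [Fintype V] {G : SimpleGraph V} [DecidableRel G.Adj] (N : Network G)

/-- The two endpoints of every edge agree on its orientation and on its availability. -/
structure Coherent (c : ∀ v, Node (G.degree v)) : Prop where
  consistent : N.Consistent c
  avl_symm : ∀ v w, N.avl c v w → N.avl c w v

variable {N} {c : ∀ v, Node (G.degree v)} {δ : ℕ}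

theorem Coherent.of_mem_passedNodes (hc : N.Coherent c) {v w : V}
    (hw : w ∈ N.passedNodes c δ v) :
    N.avl c v w ∧ N.stat c v w = some true ∧ v ∉ N.passedNodes c δ w := by
  have key : ∀ v w, w ∈ N.passedNodes c δ v → N.avl c v w ∧ N.stat c v w = some true := by
    intro v w hw
    obtain ⟨h1, h2, _⟩ := of_mem_requestedNodes (mem_requestedNodes_of_mem_passedNodes hw)
    exact ⟨hc.avl_symm _ _ h1, hc.consistent.some_iff.mp h2⟩
  refine ⟨(key v w hw).1, (key v w hw).2, fun hv => ?_⟩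
  have h1 := (key v w hw).2
  have h2 := hc.consistent.some_iff.mp (key w v hv).2
  rw [h1] at h2
  simp at h2

theorem Coherent.afterToken (hc : N.Coherent c) : N.Coherent (N.afterToken c δ) where
  consistent v w h := by
    rw [stat_afterToken, stat_afterToken, hc.consistent v w h]
    by_cases h1 : w ∈ N.passedNodes c δ v
    · have h2 := (hc.of_mem_passedNodes h1).2.2
      simp [h1, h2]
    · by_cases h2 : v ∈ N.passedNodes c δ w
      · simp [h1, h2]
      · simp [h1, h2]
  avl_symm v w := by
    rw [avl_afterToken, avl_afterToken]
    exact fun ⟨h1, h2, h3⟩ => ⟨hc.avl_symm _ _ h1, h3, h2⟩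

theorem Coherent.load_afterToken [DecidableEq V] (hc : N.Coherent c) (v : V) :
    (N.afterToken c δ v).load + (N.passedNodes c δ v).card =
      (c v).load + (Finset.univ.filter fun a => v ∈ N.passedNodes c δ a).card := by
  classical
  rw [load_eq (N := N), load_eq (N := N), ← Finset.card_union_of_disjoint,
    ← Finset.card_union_of_disjoint]
  · congr 1
    ext w
    simp only [Finset.mem_union, Finset.mem_filter, Finset.mem_univ, true_and, stat_afterToken]
    by_cases h1 : w ∈ N.passedNodes c δ v
    · simp [h1, (hc.of_mem_passedNodes h1).2.1]
    · by_cases h2 : v ∈ N.passedNodes c δ w <;> simp [h1, h2]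
  · rw [Finset.disjoint_left]
    intro w h1 h2
    have h3 := hc.consistent.some_iff.mp (hc.of_mem_passedNodes (Finset.mem_filter.mp h2).2).2.1
    rw [(Finset.mem_filter.mp h1).2] at h3
    simp at h3
  · rw [Finset.disjoint_left]
    intro w h1 h2
    have h3 := (Finset.mem_filter.mp h1).2
    rw [stat_afterToken, if_pos h2] at h3
    simp at h3

variable (N) (c) (δ) in
/-- The local variables after `t` token steps. -/
noncomputable def afterTokens (t : ℕ) : ∀ v, Node (G.degree v) :=
  N.run (Schedule.tokenSteps δ t) c

theorem afterTokens_succ (t : ℕ) :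
    N.afterTokens c δ (t + 1) = N.afterToken (N.afterTokens c δ t) δ :=
  N.run_append _ _ _

theorem Coherent.afterTokens (hc : N.Coherent c) (t : ℕ) : N.Coherent (N.afterTokens c δ t) := by
  induction t with
  | zero => exact hc
  | succ t ih => rw [afterTokens_succ]; exact ih.afterToken

/-- Tokens are incoming edges; `E t a b` holds for the still available edges directed from `b` to
`a`. -/
theorem Coherent.isTokenRun [DecidableEq V] {Q : ℕ} (hc : N.Coherent c) (hs : N.Static Q c) :
    IsTokenRun (fun v => G.degree v / Q + 1) δ (fun t v => (N.afterTokens c δ t v).load)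
      (fun t v => (N.afterTokens c δ t v).level)
      (fun t a b => N.avl (N.afterTokens c δ t) a b ∧
        N.stat (N.afterTokens c δ t) a b = some true)
      (fun t b => N.requestedNodes (N.afterTokens c δ t) δ b)
      (fun t a => N.passedNodes (N.afterTokens c δ t) δ a) := by
  have hα : ∀ t v, (N.afterTokens c δ t v).α = G.degree v / Q + 1 :=
    fun t v => ((hs.run _) v).2.1
  have hact : ∀ t v, (N.afterTokens c δ t v).level + (G.degree v / Q + 1) + δ ≤
      (N.afterTokens c δ t v).load ↔ (N.afterTokens c δ t v).Active δ := by
    intro t v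
    rw [Node.Active, hα]
  have hcoh := fun t => hc.afterTokens (δ := δ) t
  constructor
  · intro t b h
    exact requestedNodes_of_active ((hact t b).mp h)
  · intro t b a ha
    obtain ⟨h1, h2, _⟩ := of_mem_requestedNodes ha
    exact ⟨(hcoh t).avl_symm _ _ h1, (hcoh t).consistent.some_iff.mp h2⟩
  · intro t b a ha
    exact (hact t a).mpr (of_mem_requestedNodes ha).2.2
  · intro t b
    exact (card_requestedNodes_le _).trans (hα t b).le
  · intro t a b he ha hb hr
    rw [hact] at ha hb
    refine (alpha_le_card_requestedNodes ((hcoh t).avl_symm _ _ he.1)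
      ((hcoh t).consistent.some_iff.mp he.2) ha hb hr).trans (hα t b)
  · intro t a b hb
    exact mem_requestedNodes_of_mem_passedNodes hb
  · intro t a
    exact (card_passedNodes_le _).trans (hα t a).le
  · intro t a b hr hp
    exact (card_passedNodes hr hp).trans (hα t a)
  · intro t a b
    rw [afterTokens_succ, avl_afterToken, stat_afterToken]
    by_cases h1 : b ∈ N.passedNodes (N.afterTokens c δ t) δ a
    · simp [h1]
    · by_cases h2 : a ∈ N.passedNodes (N.afterTokens c δ t) δ b
      · have := (hcoh t).consistent.some_iff.mp ((hcoh t).of_mem_passedNodes h2).2.1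
        simp [h1, h2, this]
      · simp [h1, h2]
  · intro t v
    rw [afterTokens_succ, level_afterToken]
    by_cases h : (N.afterTokens c δ t v).Active δ
    · rw [if_pos h, if_pos ((hact t v).mpr h)]
    · rw [if_neg h, if_neg (mt (hact t v).mp h)]
  · intro t v
    rw [afterTokens_succ]
    exact (hcoh t).load_afterToken v

/-- A reversal ends availability, so an edge has three fates: available and unused, never available,
or reversed exactly once. -/
theorem Coherent.stat_afterTokens (hc : N.Coherent c) (t : ℕ) (v w : V) :
    (N.avl (N.afterTokens c δ t) v w ∧ N.avl c v w ∧
      N.stat (N.afterTokens c δ t) v w = N.stat c v w) ∨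
    (¬ N.avl (N.afterTokens c δ t) v w ∧ ¬ N.avl c v w ∧
      N.stat (N.afterTokens c δ t) v w = N.stat c v w) ∨
    (¬ N.avl (N.afterTokens c δ t) v w ∧ N.avl c v w ∧
      N.stat (N.afterTokens c δ t) v w = (N.stat c v w).map not) := by
  induction t with
  | zero =>
    by_cases h : N.avl c v w
    · exact Or.inl ⟨h, h, rfl⟩
    · exact Or.inr (Or.inl ⟨h, h, rfl⟩)
  | succ t ih =>
    have hcoh := hc.afterTokens (δ := δ) t
    rw [afterTokens_succ, avl_afterToken, stat_afterToken]
    by_cases h1 : w ∈ N.passedNodes (N.afterTokens c δ t) δ v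
    · obtain ⟨h2, h3, _⟩ := hcoh.of_mem_passedNodes h1
      rcases ih with ⟨_, h4, h5⟩ | ⟨h4, _⟩ | ⟨h4, _⟩
      · rw [h3] at h5
        simp [h1, h4, ← h5]
      · exact absurd h2 h4
      · exact absurd h2 h4
    · by_cases h0 : v ∈ N.passedNodes (N.afterTokens c δ t) δ w
      · obtain ⟨h2, h3, _⟩ := hcoh.of_mem_passedNodes h0
        replace h2 := hcoh.avl_symm _ _ h2
        replace h3 := hcoh.consistent.some_iff.mp h3
        rcases ih with ⟨_, h4, h5⟩ | ⟨h4, _⟩ | ⟨h4, _⟩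
        · rw [h3] at h5
          simp [h0, h1, h4, ← h5]
        · exact absurd h2 h4
        · exact absurd h2 h4
      · simpa [h0, h1] using ih

/-! ### The effect of a whole phase. -/

section Phase

variable {D k Q S : ℕ}

theorem coherent_afterAccept (hs : N.Static Q c) (hc : N.Consistent c) :
    N.Coherent (N.afterAccept c D k) where
  consistent v w h := by
    rw [stat_afterAccept, stat_afterAccept, hc v w h]
    by_cases h1 : w ∈ N.acceptedNodes c D k v
    · simp [h1, notMem_acceptedNodes hs h1]
    · by_cases h2 : v ∈ N.acceptedNodes c D k w <;> simp [h1, h2]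
  avl_symm v w := by
    intro h
    have hadj : G.Adj v w := h.1
    rw [avl_afterAccept hs] at h ⊢
    rw [theta_symm hadj]
    rcases h with ⟨h1, h2⟩ | ⟨h1, h2⟩
    · exact Or.inr ⟨hc.some_iff.mp h1, by linarith⟩
    · exact Or.inl ⟨hc.some_iff.mp h1, by linarith⟩

theorem load_afterAccept (hs : N.Static Q c) (hc : N.Consistent c) (v : V) :
    (N.afterAccept c D k v).load = (c v).load + (N.acceptedNodes c D k v).card := by
  classical
  rw [load_eq (N := N), load_eq (N := N), ← Finset.card_union_of_disjoint]
  · congr 1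
    ext w
    simp only [Finset.mem_union, Finset.mem_filter, Finset.mem_univ, true_and, stat_afterAccept]
    by_cases h1 : w ∈ N.acceptedNodes c D k v
    · simp [h1]
    · by_cases h2 : v ∈ N.acceptedNodes c D k w
      · obtain ⟨h3, h4, _⟩ := of_mem_acceptedNodes hs h2
        simp [h1, h2, (hc.none_iff h3).mp h4]
      · simp [h1, h2]
  · rw [Finset.disjoint_left]
    intro w h1 h2
    have h3 := (of_mem_acceptedNodes hs h2).2.1
    rw [(Finset.mem_filter.mp h1).2] at h3
    simp at h3

/-- Only an inequality, because edges accepted at the other end also cease to be free. -/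
theorem free_afterAccept (hs : N.Static Q c) (v : V) :
    (N.afterAccept c D k v).free + (N.acceptedNodes c D k v).card ≤ (c v).free := by
  classical
  rw [free_eq (N := N), free_eq (N := N), ← Finset.card_union_of_disjoint]
  · refine Finset.card_le_card fun w => ?_
    simp only [Finset.mem_union, Finset.mem_filter, Finset.mem_univ, true_and, stat_afterAccept]
    rintro (⟨h1, h2⟩ | h1)
    · split_ifs at h2
      exact ⟨h1, h2⟩
    · obtain ⟨h2, h3, _⟩ := of_mem_acceptedNodes hs h1
      exact ⟨h2, h3⟩
  · rw [Finset.disjoint_left]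
    intro w h1 h2
    have h3 := (Finset.mem_filter.mp h1).2.2
    rw [stat_afterAccept, if_pos h2] at h3
    simp at h3

variable (N) (c) (D k δ S) in
/-- The local variables after one phase. -/
noncomputable def afterPhase : ∀ v, Node (G.degree v) :=
  N.afterTokens (N.afterAccept c D k) δ S

theorem consistent_afterPhase (hs : N.Static Q c) (hc : N.Consistent c) :
    N.Consistent (N.afterPhase c δ D k S) :=
  ((coherent_afterAccept hs hc).afterTokens S).consistent

theorem stat_afterPhase_eq_none (hs : N.Static Q c) (hc : N.Consistent c) {v w : V} :
    N.stat (N.afterPhase c δ D k S) v w = none ↔ N.stat (N.afterAccept c D k) v w = none := by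
  rcases (coherent_afterAccept (D := D) (k := k) hs hc).stat_afterTokens (δ := δ) S v w with
    h | h | h <;> rw [afterPhase, h.2.2]
  exact Option.map_eq_none_iff

theorem free_afterPhase (hs : N.Static Q c) (hc : N.Consistent c) (v : V) :
    (N.afterPhase c δ D k S v).free = (N.afterAccept c D k v).free := by
  classical
  rw [free_eq (N := N), free_eq (N := N)]
  simp only [stat_afterPhase_eq_none hs hc]

/-- An edge still above the bound would have been rejected by an end whose free count dropped by
`k`. -/
theorem free_afterPhase_add_free_le (hs : N.Static Q c) (hc : N.Consistent c) {v w : V}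
    (h : G.Adj v w) (hn : N.stat (N.afterPhase c δ D k S) v w = none)
    (hk : (c v).free + (c w).free ≤ D + k + 1) :
    (N.afterPhase c δ D k S v).free + (N.afterPhase c δ D k S w).free ≤ D + 1 := by
  rw [free_afterPhase hs hc, free_afterPhase hs hc]
  have h1 := free_afterAccept (D := D) (k := k) hs v
  have h2 := free_afterAccept (D := D) (k := k) hs w
  by_cases hD : (c v).free + (c w).free ≤ D + 1
  · omega
  rw [stat_afterPhase_eq_none hs hc, stat_afterAccept] at hn
  split_ifs at hn with h3 h4
  have := card_acceptedNodes hs hc h hn (by omega) h3 h4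
  omega

/-- Only proposing edges become oriented. As free counts are at most degrees, this bounds the degree
of an oriented edge from below. -/
theorem lt_free_of_stat_afterPhase (hs : N.Static Q c) (hc : N.Consistent c) {v w : V} {b : Bool}
    (hn : N.stat (N.afterPhase c δ D k S) v w = some b) :
    D + 1 < (c v).free + (c w).free ∨ N.stat c v w ≠ none := by
  have h1 : N.stat (N.afterAccept c D k) v w ≠ none := by
    rw [Ne, ← stat_afterPhase_eq_none (δ := δ) (S := S) hs hc, hn]
    simp
  rw [stat_afterAccept] at h1
  split_ifs at h1 with h3 h4
  · exact Or.inl (of_mem_acceptedNodes hs h3).2.2.1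
  · have := (of_mem_acceptedNodes hs h4).2.2.1
    left
    omega
  · exact Or.inr h1

/-- The effect of a phase on the imbalance of an oriented edge. -/
theorem imbalance_afterPhase (hs : N.Static Q c) (hc : N.Consistent c) (hQ : 0 < Q)
    (hk : k ≤ S * δ) {v w : V} (hvw : N.stat (N.afterPhase c δ D k S) v w = some true) :
    ((N.afterPhase c δ D k S v).load : ℝ) - (N.afterPhase c δ D k S w).load - N.theta v w ≤
      S * δ + 2 * ((G.degree v / Q + 1 : ℕ) : ℝ) + δ ∨
    N.stat c v w = some true ∧
    ((N.afterPhase c δ D k S v).load : ℝ) - (N.afterPhase c δ D k S w).load - N.theta v w ≤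
      ((c v).load : ℝ) - (c w).load - N.theta v w +
        (δ * (Q * (Q + 2) + 1) + 2 * ((G.degree v / Q + 1 : ℕ) : ℝ)) := by
  classical
  have hadj := adj_of_stat hvw
  have hcoh := coherent_afterAccept (D := D) (k := k) hs hc
  have H := hcoh.isTokenRun (δ := δ) (hs.run _)
  have h0 : ∀ v, N.afterTokens (N.afterAccept c D k) δ 0 v = N.afterAccept c D k v := fun _ => rfl
  have hlow : (c w).load ≤ (N.afterPhase c δ D k S w).level := H.level_mono w S.zero_le
  have hlow' : (N.afterPhase c δ D k S w).level ≤ (N.afterPhase c δ D k S w).load := by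
    refine H.level_le_tokens (fun v => ?_) S w
    simp only [h0, level_afterAccept, load_afterAccept hs hc]
    omega
  have hup : (N.afterPhase c δ D k S v).load ≤
      (N.afterPhase c δ D k S v).level + 2 * (G.degree v / Q + 1) + δ := by
    have := H.tokens_le (k := k) (fun v => ?_) S v
    · simp only [afterPhase]
      omega
    simp only [h0, level_afterAccept, load_afterAccept hs hc]
    have := card_acceptedNodes_le (N := N) (c := c) (D := D) (k := k) v
    omega
  have hlev : (N.afterPhase c δ D k S v).level ≤ (c v).load + S * δ := H.level_le S v
  generalize G.degree v / Q + 1 = α at hup ⊢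
  rify at hlow hlow' hup hlev
  rcases hcoh.stat_afterTokens (δ := δ) S v w with ⟨h1, h2, h3⟩ | ⟨h1, h2, h3⟩ | ⟨h1, h2, h3⟩
  -- Tight and unused: the level gap controls the growth.
  · right
    have hB : ∀ v, (G.neighborFinset v).card < Q * (G.degree v / Q + 1) := fun v => by
      rw [SimpleGraph.card_neighborFinset_eq_degree, mul_add, mul_one, add_comm]
      have := Nat.div_add_mod (G.degree v) Q
      have := Nat.mod_lt (G.degree v) hQ
      omega
    have hgap := H.level_sub_le hB (fun a b he => by simpa using he.1.1)
      (fun a b he => by simpa using he.1.1.symm) (T := S) ⟨h1, hvw⟩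
    have hgap' : (N.afterPhase c δ D k S v).level + (c w).load ≤
      (c v).load + (N.afterPhase c δ D k S w).level + δ * (Q * (Q + 2)) := hgap
    rify at hgap'
    refine ⟨?_, ?_⟩
    · rw [afterPhase, h3, stat_afterAccept] at hvw
      rw [avl_afterAccept hs] at h2
      rcases h2 with h2 | h2
      · exact h2.1
      · rw [h2.1] at hvw
        split_ifs at hvw with h4 h5
        · have := (of_mem_acceptedNodes hs h4).2.1
          rw [h2.1] at this
          simp at this
        · simp at hvw
        · simp at hvw
    · linarith
  -- Never available: newly accepted, or of negative excess before the phase. Either way the old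
  -- loads differ by at most `theta`.
  · left
    rw [afterPhase, h3, stat_afterAccept] at hvw
    have : ((c v).load : ℝ) - (c w).load ≤ N.theta v w := by
      split_ifs at hvw with h4 h5
      · exact (of_mem_acceptedNodes hs h4).2.2.2
      · simp at hvw
      · by_contra! h6
        exact h2 ((avl_afterAccept hs v w).mpr (Or.inl ⟨hvw, h6.le⟩))
    linarith
  -- Reversed: the edge was tight in the direction of `w`, which is the same bound on the old loads.
  · left
    have h4 : N.stat (N.afterAccept c D k) v w = some false := by
      rw [afterPhase, h3] at hvw
      cases h5 : N.stat (N.afterAccept c D k) v w with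
      | none => simp [h5] at hvw
      | some b => simpa [h5] using hvw
    have : ((c v).load : ℝ) - (c w).load ≤ N.theta v w := by
      rw [avl_afterAccept hs] at h2
      rcases h2 with h2 | h2
      · rw [stat_afterAccept] at h4
        split_ifs at h4 with h5 h6
        · simp at h4
        · have := (of_mem_acceptedNodes hs h6).2.1
          rw [hc.none_iff hadj.symm, h2.1] at this
          simp at this
        · rw [h2.1] at h4
          simp at h4
      · exact h2.2
    linarith

end Phase

end Network

/-! ### The invariant across phases. -/

/-- Sufficient conditions for a schedule to compute an orientation of a graph of maximum degree
`Δ` in which the imbalance of an edge with `d` adjacent edges is at most `f L d`. Here `f φ d`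
bounds the imbalance at the beginning of phase `φ`. -/
structure Schedule.Sound (σ : Schedule) (Δ : ℕ) (f : ℕ → ℕ → ℝ) : Prop where
  Q_pos : 0 < σ.Q
  S_pos : 0 < σ.S
  antitone : ∀ φ, σ.D (φ + 1) ≤ σ.D φ
  D_zero : 2 * Δ ≤ σ.D 0 + 1
  D_last : σ.D σ.L = 0
  old_le : ∀ φ < σ.L, ∀ d, f φ d + (σ.increment φ * (σ.Q * (σ.Q + 2) + 1) +
    2 * (((d + 1) / σ.Q + 1 : ℕ) : ℝ)) ≤ f (φ + 1) d
  -- Smaller `d` need not be considered, since such edges are still unoriented after phase `φ`.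
  new_le : ∀ φ < σ.L, ∀ d, σ.D (φ + 1) ≤ d → σ.S * σ.increment φ +
    2 * (((d + 1) / σ.Q + 1 : ℕ) : ℝ) + σ.increment φ ≤ f (φ + 1) d

theorem Schedule.quota_le (σ : Schedule) (hS : 0 < σ.S) (φ : ℕ) :
    σ.quota φ ≤ σ.S * σ.increment φ := by
  have := Nat.div_add_mod (σ.quota φ) σ.S
  have := Nat.mod_lt (σ.quota φ) hS
  rw [increment, mul_add, mul_one]
  omega

namespace Network

variable {V : Type*} [Fintype V] {G : SimpleGraph V} [DecidableRel G.Adj] (N : Network G)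

/-- The invariant at the beginning of phase `φ`. -/
structure Invariant (σ : Schedule) (f : ℕ → ℕ → ℝ) (φ : ℕ) (c : ∀ v, Node (G.degree v)) :
    Prop where
  static : N.Static σ.Q c
  consistent : N.Consistent c
  free_le : ∀ v w, G.Adj v w → N.stat c v w = none → (c v).free + (c w).free ≤ σ.D φ + 1
  degree_ge : ∀ v w b, N.stat c v w = some b → σ.D φ + 2 ≤ G.degree v + G.degree w
  imbalance_le : ∀ v w, N.stat c v w = some true →
    ((c v).load : ℝ) - (c w).load - N.theta v w ≤ f φ (G.degree v + G.degree w - 2)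

variable {N} {c : ∀ v, Node (G.degree v)} {σ : Schedule} {f : ℕ → ℕ → ℝ}

theorem degree_pos_of_adj {v w : V} (h : G.Adj v w) : 0 < G.degree v :=
  (G.degree_pos_iff_exists_adj v).mpr ⟨w, h⟩

theorem invariant_start (hσ : σ.Sound G.maxDegree f) (ε : ℝ) :
    N.Invariant σ f 0 (N.start σ.Q ε) := by
  have hn : ∀ v w, N.stat (N.start σ.Q ε) v w = none := by
    intro v w
    by_cases h : G.Adj v w
    · rw [stat_of_adj h]; rfl
    · exact stat_of_not_adj h
  refine ⟨fun v => ⟨rfl, rfl, rfl⟩, fun v w _ => by rw [hn, hn]; rfl, fun v w _ _ => ?_,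
    fun v w b h => ?_, fun v w h => ?_⟩
  · have := (N.start σ.Q ε v).free_le
    have := (N.start σ.Q ε w).free_le
    have := G.degree_le_maxDegree v
    have := G.degree_le_maxDegree w
    have := hσ.D_zero
    omega
  · rw [hn] at h; simp at h
  · rw [hn] at h; simp at h

theorem Invariant.afterPhase (hσ : σ.Sound G.maxDegree f) {φ : ℕ} (hφ : φ < σ.L)
    (hc : N.Invariant σ f φ c) : N.Invariant σ f (φ + 1) (N.run (σ.phase φ) c) := by
  have hk := σ.quota_le hσ.S_pos φ
  have hq : σ.D (φ + 1) + σ.quota φ = σ.D φ := Nat.add_sub_cancel' (hσ.antitone φ)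
  have hrun : N.run (σ.phase φ) c =
      N.afterPhase c (σ.increment φ) (σ.D (φ + 1)) (σ.quota φ) σ.S := N.run_append _ _ _
  have hdeg : ∀ v w b, N.stat (N.run (σ.phase φ) c) v w = some b →
      σ.D (φ + 1) + 2 ≤ G.degree v + G.degree w := by
    intro v w b h
    rw [hrun] at h
    rcases lt_free_of_stat_afterPhase hc.static hc.consistent h with h | h
    · have := (c v).free_le
      have := (c w).free_le
      omega
    · obtain ⟨b, hb⟩ := Option.ne_none_iff_exists'.mp h
      have := hc.degree_ge v w b hb
      omega
  refine ⟨hc.static.run _, ?_, fun v w h hn => ?_, hdeg, fun v w h => ?_⟩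
  · rw [hrun]
    exact consistent_afterPhase hc.static hc.consistent
  · rw [hrun] at hn ⊢
    refine free_afterPhase_add_free_le hc.static hc.consistent h hn ?_
    rw [hq]
    refine hc.free_le v w h ?_
    by_contra hne
    obtain ⟨b, hb⟩ := Option.ne_none_iff_exists'.mp hne
    rw [stat_afterPhase_eq_none hc.static hc.consistent, stat_afterAccept] at hn
    split_ifs at hn
    exact hne hn
  · have hadj := adj_of_stat h
    have hd := hdeg v w _ h
    have hw := degree_pos_of_adj hadj.symm
    -- Since `w` has degree at least 1, the degree of `v` is at most `d + 1`.
    have hα : ((G.degree v / σ.Q + 1 : ℕ) : ℝ) ≤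
        ((((G.degree v + G.degree w - 2) + 1) / σ.Q + 1 : ℕ) : ℝ) := by
      exact_mod_cast Nat.add_le_add_right (Nat.div_le_div_right (by omega)) 1
    have hnew := hσ.new_le φ hφ (G.degree v + G.degree w - 2) (by omega)
    have hold := hσ.old_le φ hφ (G.degree v + G.degree w - 2)
    rw [hrun] at h ⊢
    rcases imbalance_afterPhase hc.static hc.consistent hσ.Q_pos hk h with h' | ⟨h1, h'⟩
    · linarith
    · have := hc.imbalance_le v w h1
      linarith

theorem invariant_phases (hσ : σ.Sound G.maxDegree f) (ε : ℝ) {φ : ℕ} (hφ : φ ≤ σ.L) :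
    N.Invariant σ f φ (N.run (σ.phases φ) (N.start σ.Q ε)) := by
  induction φ with
  | zero => exact invariant_start hσ ε
  | succ φ ih =>
    rw [Schedule.phases, run_append]
    exact (ih (by omega)).afterPhase hσ hφ

/-- An unoriented edge is counted at both ends, against the final bound `0 + 1`. -/
theorem Invariant.stat_ne_none (hσ : σ.Sound G.maxDegree f) (hc : N.Invariant σ f σ.L c)
    {v w : V} (h : G.Adj v w) : N.stat c v w ≠ none := by
  intro hn
  have h1 := hc.free_le v w h hn
  have key : ∀ v w, G.Adj v w → N.stat c v w = none → 0 < (c v).free := by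
    classical
    intro v w h hn
    rw [free_eq (N := N), Finset.card_pos]
    exact ⟨w, by simp [h, hn]⟩
  have h2 := key v w h hn
  have h3 := key w v h.symm ((hc.consistent.none_iff h).mp hn)
  rw [hσ.D_last] at h1
  omega

end Network

/-! ### From the invariant to a balanced orientation. -/

theorem degree_add_degree_le_edgeDegree {V : Type*} [Fintype V] {G : SimpleGraph V}
    [DecidableRel G.Adj] {v w : V} (h : G.Adj v w) :
    G.degree v + G.degree w - 2 ≤ edgeDegree G s(v, w) := by
  classical
  have hne : v ≠ w := h.ne
  have hsub : (((G.neighborFinset v).erase w).image (fun x => s(v, x)) ∪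
      ((G.neighborFinset w).erase v).image (fun x => s(w, x)) : Finset (Sym2 V)) ⊆
      {e' : Sym2 V | e' ∈ G.edgeSet ∧ e' ≠ s(v, w) ∧ ∃ x, x ∈ s(v, w) ∧ x ∈ e'}.toFinset := by
    intro e
    simp only [Finset.mem_union, Finset.mem_image, Finset.mem_erase, Set.mem_toFinset,
      SimpleGraph.mem_neighborFinset]
    rintro (⟨x, ⟨hx, hvx⟩, rfl⟩ | ⟨x, ⟨hx, hwx⟩, rfl⟩)
    · refine ⟨hvx, fun he => ?_, v, by simp, by simp⟩
      simp only [Sym2.eq_iff] at he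
      grind
    · refine ⟨hwx, fun he => ?_, w, by simp, by simp⟩
      simp only [Sym2.eq_iff] at he
      grind
  have hcard := Finset.card_le_card hsub
  rw [Finset.card_union_of_disjoint, Finset.card_image_of_injective, Finset.card_image_of_injective,
    Finset.card_erase_of_mem (by simpa using h), Finset.card_erase_of_mem (by simpa using h.symm),
    SimpleGraph.card_neighborFinset_eq_degree, SimpleGraph.card_neighborFinset_eq_degree] at hcard
  · rw [edgeDegree, Set.ncard_eq_toFinset_card']
    omega
  · exact fun x y hxy => Sym2.congr_right.mp hxy
  · exact fun x y hxy => Sym2.congr_right.mp hxy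
  · rw [Finset.disjoint_left]
    simp only [Finset.mem_image, Finset.mem_erase, SimpleGraph.mem_neighborFinset]
    rintro _ ⟨x, ⟨hx, _⟩, rfl⟩ ⟨y, ⟨hy, _⟩, he⟩
    simp only [Sym2.eq_iff] at he
    grind

namespace Network

variable {V : Type*} [Fintype V] {G : SimpleGraph V} [DecidableRel G.Adj] {N : Network G}

/-- After a sound schedule every edge is oriented, so the default value in `output` plays no role.
-/
theorem outcome_iff {σ : Params → Schedule} {ε : ℝ} {f : ℕ → ℕ → ℝ}
    (hσ : (σ (N.params ε)).Sound G.maxDegree f) (u v : V) :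
    N.outcome (Schedule.algorithm σ) ε u v ↔
      N.stat (N.run ((σ (N.params ε)).phases (σ (N.params ε)).L)
        (N.start (σ (N.params ε)).Q ε)) v u = some true := by
  by_cases h : G.Adj v u
  · have hne := (invariant_phases (N := N) hσ ε le_rfl).stat_ne_none hσ h
    obtain ⟨b, hb⟩ := Option.ne_none_iff_exists'.mp hne
    have hex : N.outcome (Schedule.algorithm σ) ε u v ↔
        (Schedule.algorithm σ).output (N.state (Schedule.algorithm σ) ε
          ((Schedule.algorithm σ).rounds (N.params ε)) v) (N.port v ⟨u, h⟩) = true :=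
      ⟨fun ⟨_, h⟩ => h, fun h' => ⟨h, h'⟩⟩
    have hr : (Schedule.algorithm σ).rounds (N.params ε) =
      ((σ (N.params ε)).phases (σ (N.params ε)).L).length := rfl
    rw [hex, state_algorithm, hr, List.take_length, hb]
    rw [stat_of_adj h] at hb
    simp [Schedule.algorithm, hb]
  · rw [stat_of_not_adj h]
    simp only [reduceCtorEq, iff_false]
    exact fun h' => h h'.1

/-- A sound schedule yields a balanced orientation. -/
theorem isBalancedOrientation_of_sound {σ : Params → Schedule} {ε β : ℝ} {f : ℕ → ℕ → ℝ}
    (hσ : (σ (N.params ε)).Sound G.maxDegree f) (hε : 0 ≤ ε)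
    (hf : ∀ d : ℕ, f (σ (N.params ε)).L d ≤ 1 + ε / 2 * d + β) :
    IsBalancedOrientation G N.side N.η ε β (N.outcome (Schedule.algorithm σ) ε) := by
  have hout := outcome_iff hσ
  have hinv := invariant_phases (N := N) hσ ε le_rfl
  generalize N.run ((σ (N.params ε)).phases (σ (N.params ε)).L)
    (N.start (σ (N.params ε)).Q ε) = c at hout hinv
  have hdeg : ∀ v, inDegree (N.outcome (Schedule.algorithm σ) ε) v = (c v).load := by
    classical
    intro v
    rw [inDegree, load_eq (N := N), Set.ncard_eq_toFinset_card']
    congr 1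
    ext w
    simp [hout]
  have hbal : ∀ v w, N.outcome (Schedule.algorithm σ) ε w v →
      (inDegree (N.outcome (Schedule.algorithm σ) ε) v : ℝ) -
        inDegree (N.outcome (Schedule.algorithm σ) ε) w ≤
      N.theta v w + 1 + ε / 2 * (edgeDegree G s(v, w) : ℝ) + β := by
    intro v w h
    rw [hout] at h
    have h1 := hinv.imbalance_le v w h
    have h2 := hf (G.degree v + G.degree w - 2)
    have h3 : ((G.degree v + G.degree w - 2 : ℕ) : ℝ) ≤ edgeDegree G s(v, w) := by
      exact_mod_cast degree_add_degree_le_edgeDegree (adj_of_stat h)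
    have h4 := mul_le_mul_of_nonneg_left h3 (by positivity : 0 ≤ ε / 2)
    rw [hdeg, hdeg]
    linarith
  refine ⟨⟨fun u v h => ?_, fun u v h => ?_, fun u v h => ?_⟩, fun u v hu hv h => ?_,
    fun u v hu hv h => ?_⟩
  · exact (adj_of_stat ((hout u v).mp h)).symm
  · rw [hout, hout]
    obtain ⟨b, hb⟩ := Option.ne_none_iff_exists'.mp (hinv.stat_ne_none hσ h)
    cases b with
    | true => exact Or.inr hb
    | false => exact Or.inl (hinv.consistent.some_iff.mp hb)
  · rw [hout] at h ⊢
    rw [hinv.consistent.some_iff.mp h]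
    simp
  · have := hbal v u h
    rwa [theta, hv, if_neg (by simp), Sym2.eq_swap] at this
  · have := hbal u v h
    rwa [theta, hu, if_pos rfl] at this

/-- If no two edges are adjacent, an orientation according to the edge parameters is balanced. -/
theorem isBalancedOrientation_of_maxDegree_le_one {σ : Params → Schedule} {ε β : ℝ}
    (hL : (σ (N.params ε)).L = 0) (hG : G.maxDegree ≤ 1) (hε : 0 ≤ ε) (hβ : 0 ≤ β) :
    IsBalancedOrientation G N.side N.η ε β (N.outcome (Schedule.algorithm σ) ε) := by
  have hout : ∀ u v, N.outcome (Schedule.algorithm σ) ε u v ↔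
      G.Adj u v ∧ if N.side v then N.η s(u, v) < 0 else 0 ≤ N.η s(u, v) := by
    intro u v
    have hr : (Schedule.algorithm σ).rounds (N.params ε) = 0 := by
      simp [Schedule.algorithm, hL, Schedule.phases]
    rw [outcome, hr, G.adj_comm u v, ← exists_prop]
    refine exists_congr fun h => ?_
    have hη : N.η s(v, N.neighbor v (N.port v ⟨u, h⟩)) = N.η s(u, v) := by
      rw [neighbor_port, Sym2.eq_swap]
    simp only [state, Schedule.algorithm, Node.ofInput, nodeInput, hη]
    cases N.side v <;> simp
  -- Loads are at most 1, and the sign rule makes the contribution of `η` nonnegative in the chosen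
  -- direction.
  have hdeg : ∀ v, inDegree (N.outcome (Schedule.algorithm σ) ε) v ≤ 1 := by
    intro v
    refine le_trans ?_ ((G.degree_le_maxDegree v).trans hG)
    rw [← SimpleGraph.card_neighborFinset_eq_degree, ← Set.ncard_coe_finset]
    refine Set.ncard_le_ncard (fun u hu => ?_) (Set.toFinite _)
    simpa using ((hout u v).mp hu).1.symm
  have hnn : ∀ e, 0 ≤ ε / 2 * (edgeDegree G e : ℝ) := fun e => by positivity
  refine ⟨⟨fun u v h => ((hout u v).mp h).1, fun u v h => ?_, fun u v h => ?_⟩,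
    fun u v hu hv h => ?_, fun u v hu hv h => ?_⟩
  · have hs : N.side u ≠ N.side v := N.side.valid h
    rw [hout, hout, Sym2.eq_swap (a := v)]
    simp only [h, h.symm, true_and]
    rcases lt_or_ge (N.η s(u, v)) 0 with h0 | h0 <;>
      cases hu : N.side u <;> cases hv : N.side v <;> simp_all
  · have hs : N.side u ≠ N.side v := N.side.valid ((hout u v).mp h).1
    rw [hout] at h ⊢
    rw [Sym2.eq_swap (a := v)]
    rintro ⟨_, h2⟩
    replace h := h.2
    cases hu : N.side u <;> cases hv : N.side v <;> simp_all <;> linarith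
  · have h1 := (hout u v).mp h
    rw [hv, if_neg (by simp)] at h1
    have h2 : (inDegree (N.outcome (Schedule.algorithm σ) ε) v : ℝ) ≤ 1 := by
      exact_mod_cast hdeg v
    have h3 : (0 : ℝ) ≤ inDegree (N.outcome (Schedule.algorithm σ) ε) u := Nat.cast_nonneg _
    linarith [hnn s(u, v)]
  · have h1 := (hout v u).mp h
    rw [hu, if_pos rfl, Sym2.eq_swap] at h1
    have h2 : (inDegree (N.outcome (Schedule.algorithm σ) ε) u : ℝ) ≤ 1 := by
      exact_mod_cast hdeg u
    have h3 : (0 : ℝ) ≤ inDegree (N.outcome (Schedule.algorithm σ) ε) v := Nat.cast_nonneg _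
    linarith [hnn s(u, v)]

end Network

/-! ### Choice of the parameters. -/

/-- The schedule that is used on graphs with the given parameters. -/
noncomputable def schedule (p : Params) : Schedule :=
  -- The extra 1 makes `(1 - ε/32) ^ L * 2Δ < 1` strict, so that the floor vanishes.
  let L := if p.maxDegree ≤ 1 then 0 else ⌈32 * Real.log (2 * p.maxDegree) / p.ε⌉₊ + 1
  let Q := ⌈32 * (L : ℝ) / p.ε⌉₊
  { L := L
    Q := Q
    S := ⌈8 * ((Q : ℝ) + 1) ^ 2 / p.ε⌉₊
    D := fun φ => ⌊(1 - p.ε / 32) ^ φ * (2 * p.maxDegree)⌋₊ }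

/-- The bound on the imbalance of an edge at the beginning of a phase. -/
noncomputable def Schedule.imbalanceBound (σ : Schedule) (ε β : ℝ) (φ d : ℕ) : ℝ :=
  -- The subtracted term reserves the cost of the remaining phases: a fixed cost for each, and a
  -- cost per unit of quota, with `D φ` bounding the quotas to come.
  1 + ε / 2 * d + β - (((σ.Q + 1) ^ 2 + 2 * ((d + 1) / σ.Q + 1)) * (σ.L - φ) +
    (σ.Q + 1) ^ 2 / σ.S * σ.D φ)

/-- For old edges the reserve pays for the phase. For new edges, twice the quota, the batch sizes
over all phases and the reserved quotas each take about `ε d / 8`, within the allowance `ε d / 2`;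
constants go into `β`. -/
theorem schedule_sound {p : Params} {β : ℝ} (hε : 0 < p.ε) (hε1 : p.ε ≤ 1)
    (hΔ : 2 ≤ p.maxDegree)
    (hβ : (schedule p).S + (schedule p).L * ((schedule p).Q + 1) ^ 2 + 2 * (schedule p).L + 5 ≤ β) :
    (schedule p).Sound p.maxDegree ((schedule p).imbalanceBound p.ε β) := by
  have hΔ' : (2 : ℝ) ≤ p.maxDegree := by exact_mod_cast hΔ
  have hL : 32 * Real.log (2 * p.maxDegree) / p.ε < (schedule p).L := by
    simp only [schedule, if_neg (show ¬ p.maxDegree ≤ 1 by omega)]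
    push_cast
    linarith [Nat.le_ceil (32 * Real.log (2 * p.maxDegree) / p.ε)]
  have hlog : 0 ≤ Real.log (2 * p.maxDegree) := Real.log_nonneg (by linarith)
  have hL0 : (0 : ℝ) < (schedule p).L := lt_of_le_of_lt (by positivity) hL
  have hL1 : (1 : ℝ) ≤ (schedule p).L := by
    exact_mod_cast (by exact_mod_cast hL0 : 0 < (schedule p).L)
  have hQ : 32 * ((schedule p).L : ℝ) / p.ε ≤ (schedule p).Q := Nat.le_ceil _
  have hQ0 : (0 : ℝ) < (schedule p).Q := lt_of_lt_of_le (by positivity) hQ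
  have hS : 8 * (((schedule p).Q : ℝ) + 1) ^ 2 / p.ε ≤ (schedule p).S := Nat.le_ceil _
  have hS0 : (0 : ℝ) < (schedule p).S := lt_of_lt_of_le (by positivity) hS
  have hS1 : (1 : ℝ) ≤ (schedule p).S := by
    exact_mod_cast (by exact_mod_cast hS0 : 0 < (schedule p).S)
  have hD : ∀ φ, (schedule p).D φ = ⌊(1 - p.ε / 32) ^ φ * (2 * p.maxDegree)⌋₊ := fun _ => rfl
  generalize schedule p = σ at *
  have hν0 : 0 ≤ 1 - p.ε / 32 := by linarith
  have hanti : ∀ φ, σ.D (φ + 1) ≤ σ.D φ := by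
    intro φ
    rw [hD, hD]
    refine Nat.floor_mono (mul_le_mul_of_nonneg_right ?_ (by positivity))
    exact pow_le_pow_of_le_one hν0 (by linarith) (Nat.le_succ φ)
  have hquota : ∀ φ, (σ.quota φ : ℝ) = σ.D φ - σ.D (φ + 1) := fun φ => Nat.cast_sub (hanti φ)
  have hinc : ∀ φ, (σ.increment φ : ℝ) ≤ σ.quota φ / σ.S + 1 := by
    intro φ
    rw [Schedule.increment]
    push_cast
    linarith [Nat.cast_div_le (α := ℝ) (m := σ.quota φ) (n := σ.S)]
  have hα : ∀ d : ℕ, (((d + 1) / σ.Q + 1 : ℕ) : ℝ) ≤ ((d : ℝ) + 1) / σ.Q + 1 := by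
    intro d
    have := Nat.cast_div_le (α := ℝ) (m := d + 1) (n := σ.Q)
    push_cast at this ⊢
    linarith
  refine ⟨by exact_mod_cast hQ0, by exact_mod_cast hS0, hanti, ?_, ?_, ?_, ?_⟩
  · rw [hD, pow_zero, one_mul]
    have : ⌊(2 * p.maxDegree : ℝ)⌋₊ = 2 * p.maxDegree := by
      exact_mod_cast Nat.floor_natCast (R := ℝ) (2 * p.maxDegree)
    omega
  · rw [hD, Nat.floor_eq_zero]
    have h1 : (1 - p.ε / 32) ^ σ.L ≤ Real.exp (-(p.ε / 32 * σ.L)) := by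
      calc _ ≤ Real.exp (-(p.ε / 32)) ^ σ.L :=
            pow_le_pow_left₀ hν0 (Real.one_sub_le_exp_neg _) _
        _ = _ := by rw [← Real.exp_nat_mul]; congr 1; ring
    have h2 : Real.log (2 * p.maxDegree) < p.ε / 32 * σ.L := by
      rw [div_lt_iff₀ hε] at hL
      linarith
    calc (1 - p.ε / 32) ^ σ.L * (2 * p.maxDegree)
        ≤ Real.exp (-(p.ε / 32 * σ.L)) * (2 * p.maxDegree) :=
          mul_le_mul_of_nonneg_right h1 (by positivity)
      _ = Real.exp (-(p.ε / 32 * σ.L) + Real.log (2 * p.maxDegree)) := by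
          rw [Real.exp_add, Real.exp_log (by linarith)]
      _ < 1 := by rw [Real.exp_lt_one_iff]; linarith
  · intro φ _ d
    have h1 : (σ.increment φ : ℝ) * (σ.Q * (σ.Q + 2) + 1) ≤
        (σ.Q + 1) ^ 2 + (σ.Q + 1) ^ 2 / σ.S * σ.quota φ := by
      calc _ = (σ.increment φ : ℝ) * (σ.Q + 1) ^ 2 := by ring
        _ ≤ (σ.quota φ / σ.S + 1) * (σ.Q + 1) ^ 2 :=
          mul_le_mul_of_nonneg_right (hinc φ) (by positivity)
        _ = _ := by ring
    have h2 := hα d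
    rw [hquota] at h1
    rw [Schedule.imbalanceBound, Schedule.imbalanceBound]
    push_cast at h2 ⊢
    linarith
  · intro φ hφ d hd
    have hd' : (σ.D (φ + 1) : ℝ) ≤ d := by exact_mod_cast hd
    have hq : (σ.quota φ : ℝ) ≤ p.ε / 16 * (d + 1) + 1 := by
      have h1 : (σ.D φ : ℝ) ≤ (1 - p.ε / 32) ^ φ * (2 * p.maxDegree) := by
        rw [hD]
        exact Nat.floor_le (by positivity)
      have h2 : (1 - p.ε / 32) ^ (φ + 1) * (2 * p.maxDegree) < σ.D (φ + 1) + 1 := by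
        rw [hD]
        exact Nat.lt_floor_add_one _
      have h3 : 0 ≤ (1 - p.ε / 32) ^ φ * (2 * p.maxDegree) := by positivity
      rw [hquota]
      rw [pow_succ, mul_right_comm] at h2
      generalize (1 - p.ε / 32) ^ φ * (2 * p.maxDegree) = R at h1 h2 h3
      -- Uses `1 - ε/32 ≥ 1/2`.
      have h4 : R ≤ 2 * (d + 1) := by nlinarith
      have h5 : p.ε / 32 * R ≤ p.ε / 32 * (2 * (d + 1)) :=
        mul_le_mul_of_nonneg_left h4 (by positivity)
      linarith
    have hLQ : (2 * σ.L + 2) * (((d : ℝ) + 1) / σ.Q) ≤ p.ε / 8 * (d + 1) := by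
      rw [← mul_div_assoc, div_le_iff₀ hQ0]
      rw [div_le_iff₀ hε] at hQ
      have : (0 : ℝ) ≤ d + 1 := by positivity
      nlinarith
    have hB : ((σ.Q : ℝ) + 1) ^ 2 / σ.S ≤ p.ε / 8 := by
      rw [div_le_iff₀ hS0]
      rw [div_le_iff₀ hε] at hS
      linarith
    have hBd : ((σ.Q : ℝ) + 1) ^ 2 / σ.S * σ.D (φ + 1) ≤ p.ε / 8 * d :=
      mul_le_mul hB hd' (by positivity) (by positivity)
    have hSi : (σ.S : ℝ) * σ.increment φ ≤ σ.quota φ + σ.S := by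
      calc _ ≤ (σ.S : ℝ) * (σ.quota φ / σ.S + 1) := mul_le_mul_of_nonneg_left (hinc φ) hS0.le
        _ = _ := by field_simp
    have hi : (σ.increment φ : ℝ) ≤ σ.quota φ + 1 :=
      (hinc φ).trans (add_le_add_left (div_le_self (by positivity) hS1) _)
    have hA : (((σ.Q : ℝ) + 1) ^ 2 + 2 * ((d + 1) / σ.Q + 1)) * (σ.L - (φ + 1 : ℕ)) ≤
        (((σ.Q : ℝ) + 1) ^ 2 + 2 * ((d + 1) / σ.Q + 1)) * σ.L := by
      refine mul_le_mul_of_nonneg_left ?_ (by positivity)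
      linarith [Nat.cast_nonneg (α := ℝ) (φ + 1)]
    have h2 := hα d
    have hεd : 0 ≤ p.ε * d := by positivity
    rw [Schedule.imbalanceBound]
    linarith

/-- With `u = log Δ` and `x = 1/ε`, the orders are `L ~ u x`, `Q ~ u x²`, `S ~ u² x⁵`; rounding is
absorbed by `1 ≤ 2u`, valid for `Δ ≥ 2`. -/
theorem schedule_bounds {p : Params} (hε : 0 < p.ε) (hε1 : p.ε ≤ 1) (hΔ : 2 ≤ p.maxDegree) :
    ((schedule p).L * (3 * (schedule p).S + 2) : ℝ) ≤
      10 ^ 11 * Real.log p.maxDegree ^ 4 / p.ε ^ 6 ∧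
    (schedule p).S + (schedule p).L * ((schedule p).Q + 1) ^ 2 + 2 * (schedule p).L + 5 ≤
      10 ^ 9 * Real.log p.maxDegree ^ 3 / p.ε ^ 5 := by
  have hΔ' : (2 : ℝ) ≤ p.maxDegree := by exact_mod_cast hΔ
  obtain ⟨u, hu⟩ : ∃ u, u = Real.log p.maxDegree := ⟨_, rfl⟩
  obtain ⟨x, hx⟩ : ∃ x, x = 1 / p.ε := ⟨_, rfl⟩
  have hx1 : 1 ≤ x := by rw [hx]; exact one_le_one_div hε hε1
  have hu2 : Real.log 2 ≤ u := hu ▸ Real.log_le_log (by norm_num) hΔ'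
  have hu1 : 1 ≤ 2 * u := by linarith [Real.log_two_gt_d9]
  have hux : 1 ≤ 2 * (u * x) := by nlinarith
  have hL : ((schedule p).L : ℝ) ≤ 68 * (u * x) := by
    have h1 := Nat.ceil_lt_add_one (a := 32 * Real.log (2 * p.maxDegree) / p.ε)
      (div_nonneg (mul_nonneg (by norm_num) (Real.log_nonneg (by linarith))) hε.le)
    have h2 : Real.log (2 * p.maxDegree) ≤ 2 * u := by
      rw [Real.log_mul (by norm_num) (by linarith), ← hu]
      linarith
    have h3 : 32 * Real.log (2 * p.maxDegree) / p.ε ≤ 64 * (u * x) := by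
      rw [div_eq_mul_one_div, ← hx]
      nlinarith
    simp only [schedule, if_neg (show ¬ p.maxDegree ≤ 1 by omega)]
    push_cast
    linarith
  have hQ : ((schedule p).Q : ℝ) + 1 ≤ 2180 * (u * x ^ 2) := by
    have h1 : ((schedule p).Q : ℝ) < 32 * (schedule p).L / p.ε + 1 :=
      Nat.ceil_lt_add_one (by positivity)
    have h2 : 32 * ((schedule p).L : ℝ) / p.ε ≤ 2176 * (u * x ^ 2) := by
      rw [div_eq_mul_one_div, ← hx]
      nlinarith
    have h3 : 1 ≤ 2 * (u * x ^ 2) := by nlinarith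
    linarith
  have hM : (((schedule p).Q : ℝ) + 1) ^ 2 ≤ 2180 ^ 2 * (u ^ 2 * x ^ 4) := by
    calc _ ≤ (2180 * (u * x ^ 2)) ^ 2 := pow_le_pow_left₀ (by positivity) hQ 2
      _ = _ := by ring
  have hu0 : 0 < u := by linarith
  have hx0 : 0 < x := by linarith
  have hone : ∀ n, 1 ≤ x ^ n := fun n => one_le_pow₀ hx1
  have hS : ((schedule p).S : ℝ) ≤ 38019204 * (u ^ 2 * x ^ 5) := by
    have h1 : ((schedule p).S : ℝ) < 8 * ((schedule p).Q + 1) ^ 2 / p.ε + 1 :=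
      Nat.ceil_lt_add_one (by positivity)
    have h2 : 8 * (((schedule p).Q : ℝ) + 1) ^ 2 / p.ε ≤ 38019200 * (u ^ 2 * x ^ 5) := by
      rw [div_eq_mul_one_div, ← hx]
      calc _ ≤ 8 * (2180 ^ 2 * (u ^ 2 * x ^ 4)) * x := by gcongr
        _ = _ := by ring
    have h3 : 1 ≤ 4 * (u ^ 2 * x ^ 5) := by
      have := hone 5
      have : 1 ≤ 4 * u ^ 2 := by nlinarith
      nlinarith
    linarith
  have hu4 : 1 ≤ 4 * u ^ 2 := by nlinarith
  have hS' : u ^ 2 * x ^ 5 ≤ 2 * (u ^ 3 * x ^ 5) := by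
    have : 0 ≤ u ^ 2 * x ^ 5 := by positivity
    nlinarith
  have hux' : u * x ≤ 4 * (u ^ 3 * x ^ 5) := by
    have h1 : x ≤ x ^ 5 := le_self_pow₀ hx1 (by norm_num)
    have h2 : u ≤ 4 * u ^ 3 := by nlinarith
    calc u * x ≤ (4 * u ^ 3) * x ^ 5 := by gcongr
      _ = _ := by ring
  constructor
  · rw [← hu]
    have h1 : 3 * ((schedule p).S : ℝ) + 2 ≤ 114057620 * (u ^ 2 * x ^ 5) := by
      have : 1 ≤ 4 * (u ^ 2 * x ^ 5) := by
        have := hone 5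
        nlinarith
      linarith
    calc ((schedule p).L * (3 * (schedule p).S + 2) : ℝ)
        ≤ (68 * (u * x)) * (114057620 * (u ^ 2 * x ^ 5)) := by gcongr
      _ = 7755918160 * (u ^ 3 * x ^ 6) := by ring
      -- The product has only order `u³ x⁶`; a factor `2u ≥ 1` raises it to the required form.
      _ ≤ 7755918160 * ((2 * u) * (u ^ 3 * x ^ 6)) := by
          refine mul_le_mul_of_nonneg_left ?_ (by norm_num)
          exact le_mul_of_one_le_left (by positivity) hu1
      _ ≤ 10 ^ 11 * (u ^ 4 * x ^ 6) := by
          have : 0 ≤ u ^ 4 * x ^ 6 := by positivity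
          nlinarith
      _ = _ := by rw [hx]; field_simp
  · rw [← hu]
    have h1 : ((schedule p).L : ℝ) * ((schedule p).Q + 1) ^ 2 ≤ 323163200 * (u ^ 3 * x ^ 5) := by
      calc _ ≤ (68 * (u * x)) * (2180 ^ 2 * (u ^ 2 * x ^ 4)) := by gcongr
        _ = _ := by ring
    have h2 : (10 : ℝ) ^ 9 * u ^ 3 / p.ε ^ 5 = 10 ^ 9 * (u ^ 3 * x ^ 5) := by
      rw [hx]; field_simp
    rw [h2]
    linarith

end BalancedOrientation

theorem mainTheorem4 :
    ∃ (C : ℝ) (T : ℝ) (K : ℕ) (A : BalancedOrientation.Algorithm), 0 < C ∧ 0 < T ∧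
      ∀ (V : Type*) [Fintype V] (G : SimpleGraph V) [DecidableRel G.Adj]
        (N : BalancedOrientation.Network G) (ε : ℝ), 0 < ε → ε ≤ 1 →
        (A.rounds (N.params ε) : ℝ) ≤ T * Real.log (G.maxDegree : ℝ) ^ 4 / ε ^ 6 ∧
        N.MessagesBounded A ε (K * Nat.clog 2 (Fintype.card V)) ∧
        BalancedOrientation.IsBalancedOrientation G N.side N.η ε
          (C * Real.log ((2 * G.maxDegree - 2 : ℕ) : ℝ) ^ 3 / ε ^ 5)
          (N.outcome A ε) := by
  open BalancedOrientation in
  refine ⟨10 ^ 9, 10 ^ 11, 2, Schedule.algorithm schedule, by norm_num, by norm_num, ?_⟩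
  intro V _ G _ N ε hε hε1
  have hr : (Schedule.algorithm schedule).rounds (N.params ε) =
      (schedule (N.params ε)).L * (3 * (schedule (N.params ε)).S + 2) :=
    Schedule.length_phases _ _
  rw [hr]
  have hlog : 0 ≤ Real.log ((2 * G.maxDegree - 2 : ℕ) : ℝ) := Real.log_natCast_nonneg _
  rcases le_or_gt G.maxDegree 1 with hΔ | hΔ
  -- Here the truncated `2Δ - 2` is 0 and `Real.log 0 = 0`, so `β` is 0 and no round is run.
  · have hL : (schedule (N.params ε)).L = 0 := if_pos hΔ
    refine ⟨?_, N.messagesBounded_algorithm _ _,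
      Network.isBalancedOrientation_of_maxDegree_le_one hL hΔ hε.le (by positivity)⟩
    rw [hL, zero_mul, Nat.cast_zero]
    have := Real.log_natCast_nonneg G.maxDegree
    positivity
  · obtain ⟨h1, h2⟩ := schedule_bounds (p := N.params ε) hε hε1 hΔ
    refine ⟨by exact_mod_cast h1, N.messagesBounded_algorithm _ _, ?_⟩
    -- For `Δ ≥ 2` one has `Δ ≤ 2Δ - 2`, which turns the bound in `log Δ` into the stated one.
    have h3 : (10 : ℝ) ^ 9 * Real.log (G.maxDegree : ℝ) ^ 3 / ε ^ 5 ≤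
        10 ^ 9 * Real.log ((2 * G.maxDegree - 2 : ℕ) : ℝ) ^ 3 / ε ^ 5 := by
      have : Real.log (G.maxDegree : ℝ) ≤ Real.log ((2 * G.maxDegree - 2 : ℕ) : ℝ) := by
        refine Real.log_le_log (by exact_mod_cast (by omega : 0 < G.maxDegree)) ?_
        exact_mod_cast (by omega : G.maxDegree ≤ 2 * G.maxDegree - 2)
      have := Real.log_natCast_nonneg G.maxDegree
      gcongr
    have hs := schedule_sound (p := N.params ε) hε hε1 hΔ (h2.trans h3)
    refine Network.isBalancedOrientation_of_sound hs hε.le fun d => ?_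
    rw [Schedule.imbalanceBound, hs.D_last]
    simp [Network.params]
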